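/- **Setting.** There are $T$ rounds and $n$ agents with fair shares $\alpha_1,\dots,\alpha_n>0$, $\sum_i\alpha_i=1$. In each round $t$ every agent $i$ privately learns a value $V_i[t]\in[0,1]$, drawn from a fixed distribution $\mathcal F_i$, independently across agents and rounds. In the *General Cost Mechanism* with payment scheme $(p_k)_{k\ge 1}$, $p_k\ge 0$, agent $i$ starts with a budget $\alpha_iT$. In each round every agent requests to bid or not, and the requests of agents whose budget is not positive are ignored. If $k\ge1$ agents bid, one of them, chosen uniformly at random, wins the item and pays $p_k$ from her budget; the others pay nothing. If $W_i[t]$ is the indicator that $i$ wins round $t$, her utility in the round is $U_i[t]=V_i[t]W_i[t]$. The *ideal utility* $v_i^*$ is the maximum of $\mathbb E_{V\sim\mathcal F_i}[V\rho(V)]$ over measurable $\rho:[0,\infty)\to[0,1]$ with $\mathbb E[\rho(V)]\le\alpha_i$. In an *$\alpha_i$-aggressive strategy*, agent $i$ requests to bid in each round $t$ with probability $\rho(V_i[t])$, where $\rho$ is a maximizer with $\mathbb E[\rho(V)]=\alpha_i$. A strategy of agent $i$ is *$\lambda$-robust* if $\frac1T\sum_{t=1}^T\mathbb E[U_i[t]]\ge\lambda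 v_i^*$ whatever the strategies of the other agents. **Theorem.** For $p_1>0$, $p_2,p_3\ge0$ and $k\in\{1,2\}$ let $$L_k=\min\Big\{1,\max\Big\{\frac1{p_k},\ \frac{p_1}{p_k-\frac{p_{k+1}}{k+1}+p_1}\Big\}\Big\},$$ where a positive number divided by $0$ is $+\infty$, and let $$\mu(p_1,p_2,p_3,k)=\max_{\gamma}\Big(\frac{\gamma}{1+k}+(1-\gamma)\Big)\min\Big\{1,\frac{1}{\frac{p_{k+1}}{k+1}\gamma+p_1(1-\gamma)}\Big\},$$ the maximum being over those $\gamma\in\Big\{L_k,\ \frac{p_1}{\frac{p_{k+1}}{k+1}-p_1}\Big\}$ that satisfy $L_k\le\gamma\le1$. Suppose that $$\lambda>\sup_{\substack{0<p_1\le 2e\\ 0\le p_2\le 4e\\ 0\le p_3\le 12e}}\ \min_{k\in\{1,2\}}\mu(p_1,p_2,p_3,k).$$ Then there are a number of players $n\ge2$ and a constant $C$ such that, with equal fair shares $\alpha_i=1/n$, the following holds for all $T\ge2$, all payment schemes $(p_k)_k$ with $p_k\ge 0$, all value distributions on $[0,1]$ and every agent $i$ with $v_i^*>0$: if a $1/n$-aggressive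 strategy of agent $i$ is $c$-robust in the General Cost Mechanism, then $$c\le\lambda+C\sqrt{\frac{\log T}{T}}.$$ -/

import Mathlib

namespace GeneralCost

noncomputable section

open MeasureTheory
open scoped unitInterval

/-! ### The optimization program -/

/-- The lower end `min {1, max {1 / p_k, p_1 / (p_k - p_{k+1}/(k+1) + p_1)}}` of the range of `γ`.
Only nonnegative `p_k` and positive `p_1` matter, and then a fraction with denominator zero stands
for `+∞`, which makes the minimum equal to `1`. -/
def gammaLow (p : ℕ → ℝ) (k : ℕ) : ℝ :=
  if p k = 0 ∨ p k - p (k + 1) / (k + 1) + p 1 = 0 then 1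
  else min 1 (max (1 / p k) (p 1 / (p k - p (k + 1) / (k + 1) + p 1)))

/-- The objective
`(γ/(1+k) + (1-γ)) * min {1, 1 / ((p_{k+1}/(k+1)) γ + p_1 (1-γ))}`, where `1/0 = +∞`. -/
def objective (p : ℕ → ℝ) (k : ℕ) (γ : ℝ) : ℝ :=
  (γ / (1 + k) + (1 - γ)) *
    (if p (k + 1) / (k + 1) * γ + p 1 * (1 - γ) = 0 then 1
     else min 1 (1 / (p (k + 1) / (k + 1) * γ + p 1 * (1 - γ))))

/-- The admissible `γ`: at most two points, one of which is always `gammaLow p k`. When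
`p_{k+1}/(k+1) = p_1` the second point is infinite, hence not admissible (in the code it is then
`0`, which is below `gammaLow p k`). -/
def gammaSet (p : ℕ → ℝ) (k : ℕ) : Set ℝ :=
  {γ | gammaLow p k ≤ γ ∧ γ ≤ 1 ∧
    (γ = gammaLow p k ∨ γ = p 1 / (p (k + 1) / (k + 1) - p 1))}

/-- `μ(p_1, p_2, p_3, k)` for `k ∈ {1, 2}`: the maximum of the objective over the admissible `γ`. -/
def mu (p : ℕ → ℝ) (k : ℕ) : ℝ := sSup (objective p k '' gammaSet p k)

/-- The range of `(p_1, p_2, p_3)` (the other values of `p` are not used by the program). -/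
def priceBox : Set (ℕ → ℝ) :=
  {p | 0 < p 1 ∧ p 1 ≤ 2 * Real.exp 1 ∧ 0 ≤ p 2 ∧ p 2 ≤ 4 * Real.exp 1 ∧
    0 ≤ p 3 ∧ p 3 ≤ 12 * Real.exp 1}

/-- The value of the program `max_{(p_1,p_2,p_3)} min_{k ∈ {1,2}} μ(p_1,p_2,p_3,k)`. -/
def programValue : ℝ := sSup ((fun p => min (mu p 1) (mu p 2)) '' priceBox)

/-! ### Ideal utility and aggressive bidding rules -/

/-- The ideal utility for the value distribution `F` and the fair share `α`: the maximum of
`E[V ρ(V)]` over measurable `ρ` with values in `[0,1]` and `E[ρ(V)] ≤ α`. -/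
def idealUtility (F : Measure ℝ) (α : ℝ) : ℝ :=
  sSup {u | ∃ ρ : ℝ → I, Measurable ρ ∧ ∫ x, (ρ x : ℝ) ∂F ≤ α ∧ u = ∫ x, x * (ρ x : ℝ) ∂F}

/-- `ρ` bids on the top `α`-quantile of `F`: it solves the problem that defines the ideal utility,
and it bids with probability exactly `α`. -/
structure IsTopQuantileRule (F : Measure ℝ) (α : ℝ) (ρ : ℝ → I) : Prop where
  measurable : Measurable ρ
  mean_eq : ∫ x, (ρ x : ℝ) ∂F = α
  optimal : ∫ x, x * (ρ x : ℝ) ∂F = idealUtility F α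

/-! ### The mechanism -/

/-- The public record of one round: the set of bidding agents (after the budgets have been
enforced) and the winner, if there is one. -/
abbrev Round (n : ℕ) : Type := Finset (Fin n) × Option (Fin n)

/-- A strategy of one agent. In round `t` (rounds are numbered from `0`) the agent knows her own
values in the rounds `0, …, t` and the public record of the rounds before `t`; she requests to bid
with a probability that depends on these. -/
structure Strategy (n : ℕ) where
  prob : (t : ℕ) → (Fin (t + 1) → ℝ) → (Fin t → Round n) → I
  measurable_prob : ∀ t h, Measurable fun v => prob t v h

/-- The aggressive strategy with the bidding rule `ρ`: request with probability `ρ(V[t])`. (Agents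
without budget are barred by the mechanism.) -/
def aggressive (n : ℕ) (ρ : ℝ → I) (hρ : Measurable ρ) : Strategy n where
  prob t v _ := ρ (v (Fin.last t))
  measurable_prob t _ := hρ.comp (measurable_pi_apply (Fin.last t))

/-- The payment of agent `j` in a round: the winner pays `p_k` when `k` agents bid, and the others
pay nothing. -/
def payment {n : ℕ} (p : ℕ → ℝ) (r : Round n) (j : Fin n) : ℝ :=
  if r.2 = some j then p r.1.card else 0

/-- The budget of agent `j` after the rounds in `h`, with initial endowment `α_j T`. -/
def budget {n : ℕ} (α : Fin n → ℝ) (T : ℕ) (p : ℕ → ℝ) {t : ℕ} (h : Fin t → Round n)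
    (j : Fin n) : ℝ :=
  α j * T - ∑ s : Fin t, payment p (h s) j

/-- The probability that agent `j` bids in round `t`, given all values up to round `t` and the
record of the earlier rounds: her request probability, or `0` if her budget is not positive. -/
def bidProb {n : ℕ} (α : Fin n → ℝ) (T : ℕ) (p : ℕ → ℝ) (π : Fin n → Strategy n) {t : ℕ}
    (v : Fin (t + 1) → Fin n → ℝ) (h : Fin t → Round n) (j : Fin n) : I :=
  if budget α T p h j ≤ 0 then 0 else (π j).prob t (fun s => v s j) h

/-- The law of the set of bidding agents when agent `j` bids with probability `q j`, independently
of the others. -/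
def bidLaw {n : ℕ} (q : Fin n → I) : PMF (Finset (Fin n)) :=
  PMF.ofFintype
    (fun S => (∏ j ∈ S, ENNReal.ofReal (q j)) * ∏ j ∈ Sᶜ, ENNReal.ofReal (1 - (q j : ℝ)))
    (by
      rw [← Fintype.prod_add]
      refine Finset.prod_eq_one fun j _ => ?_
      rw [← ENNReal.ofReal_add (q j).2.1 (sub_nonneg.2 (q j).2.2)]
      simp)

/-- The winner is uniformly random among the bidding agents; there is none if nobody bids. -/
def winnerLaw {n : ℕ} (S : Finset (Fin n)) : PMF (Option (Fin n)) :=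
  if hS : S.Nonempty then (PMF.uniformOfFinset S hS).map some else PMF.pure none

/-- The conditional law of the record of the first `t` rounds, given the values of all agents in
these rounds. -/
def recordLaw {n : ℕ} (α : Fin n → ℝ) (T : ℕ) (p : ℕ → ℝ) (π : Fin n → Strategy n) :
    (t : ℕ) → (Fin t → Fin n → ℝ) → PMF (Fin t → Round n)
  | 0, _ => PMF.pure Fin.elim0
  | t + 1, v =>
    (recordLaw α T p π t (Fin.init v)).bind fun h =>
      (bidLaw (bidProb α T p π v h)).bind fun S =>
        (winnerLaw S).map fun w => Fin.snoc (α := fun _ => Round n) h (S, w)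

/-- The average per-round utility `(1/T) ∑_t V_i[t] W_i[t]` of agent `i`. -/
def averageUtility {n T : ℕ} (i : Fin n) (v : Fin T → Fin n → ℝ) (h : Fin T → Round n) : ℝ :=
  (1 / (T : ℝ)) * ∑ t : Fin T, if (h t).2 = some i then v t i else 0

/-- The expected average per-round utility of agent `i` over `T` rounds: the values are
independent across rounds and agents, those of agent `j` with law `F j`; given the values, the
record is drawn from `recordLaw`. -/
def expectedUtility {n : ℕ} (α : Fin n → ℝ) (T : ℕ) (p : ℕ → ℝ) (F : Fin n → Measure ℝ)
    (π : Fin n → Strategy n) (i : Fin n) : ℝ :=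
  ∫ v : Fin T → Fin n → ℝ,
    ∑ h : Fin T → Round n, (recordLaw α T p π T v h).toReal * averageUtility i v h
    ∂(Measure.pi fun _ : Fin T => Measure.pi F)

/-- The strategy `s` of agent `i` is `c`-robust: whatever the strategies of the other agents, agent
`i` obtains in expectation at least `c` times her ideal utility. -/
def IsRobust {n : ℕ} (α : Fin n → ℝ) (T : ℕ) (p : ℕ → ℝ) (F : Fin n → Measure ℝ) (i : Fin n)
    (s : Strategy n) (c : ℝ) : Prop :=
  ∀ π : Fin n → Strategy n, π i = s →
    c * idealUtility (F i) (α i) ≤ expectedUtility α T p F π i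

end

end GeneralCost

namespace GeneralCost

open MeasureTheory
open scoped unitInterval

/-! ### Expectations over finite probability mass functions -/

/-! To bound the robustness from above, one bad behaviour of the opponents suffices for each payment
scheme. The opponents act as one deterministic player who chooses the bidders from the public
record. Agent `i` requests with probability 1/n independently of the past, so against such a plan
the law of the record does not depend on the value distributions, and she obtains exactly the
fraction n E[wins]/T of her ideal utility (`Plan.expectedUtility_eq`). It remains to make E[wins]
small.

The plans are of the type `Plan.Blocking`: k solvent opponents contest the rounds of a schedule of
density γ. While both sides have money, n times the win probability of `i` is on average 1 -
γk/(k+1), and n times her expected payment is a = γ p_{k+1}/(k+1) + (1-γ) p_1. Her budget T/n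
therefore lasts about T/max(1,a) rounds, and her fraction is the objective of the program at γ
(`Plan.wins_fraction_le`), provided that the opponents do not go broke before her.

The opponents own about T together and regularly pay γ p_k per round. Collisions that they win are
negligible: the uniform draw makes their expected number k times that of the contested wins of `i`,
whose small budget limits the latter, so they cost O(kT/n) in expectation
(`Plan.mean_collisionCost_le`). Hence failure is improbable in two situations. Either γ p_k is below
1, and Markov's inequality suffices (`Plan.failProb_le_of_spending`); or γ p_k is below a, so that
`i` exhausts her budget first, which a second moment bound on her payments makes precise
(`Plan.failProb_le_of_race`). At γ = `gammaLow p k` one of the two holds with weak inequality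
(`gammaLow_mul_le`), and replacing γ by (1-ε)γ creates the slack at a cost of order ε.

Extreme payments are handled by plans that hold `i` down to about 1/2, which is at most the value of
the program (`half_le_programValue`): p_1 ≤ 1, p_1 ≥ 2, p_2 ≥ 6 or p_3 ≥ 32. All other payments lie
in the box of the program, and the k with the smaller `mu` is used. For large n and T this gives a
bound below λ with no error term; the finitely many small T are absorbed by the constant C. -/

/-- The expectation of a real function under a probability mass function on a finite type. -/
noncomputable def pmfMean {β : Type*} [Fintype β] (P : PMF β) (f : β → ℝ) : ℝ :=
  ∑ b, (P b).toReal * f b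

theorem pmfMean_pure {β : Type*} [Fintype β] (b : β) (f : β → ℝ) :
    pmfMean (PMF.pure b) f = f b := by
  classical
  simp [pmfMean, PMF.pure_apply, apply_ite ENNReal.toReal]

theorem pmfMean_bind {β γ : Type*} [Fintype β] [Fintype γ] (P : PMF β) (Q : β → PMF γ)
    (f : γ → ℝ) : pmfMean (P.bind Q) f = pmfMean P fun b => pmfMean (Q b) f := by
  simp only [pmfMean, PMF.bind_apply, tsum_fintype, Finset.mul_sum]
  rw [Finset.sum_comm]
  refine Finset.sum_congr rfl fun c _ => ?_
  rw [ENNReal.toReal_sum fun b _ => ENNReal.mul_ne_top (P.apply_ne_top b) ((Q b).apply_ne_top c),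
    Finset.sum_mul]
  exact Finset.sum_congr rfl fun b _ => by rw [ENNReal.toReal_mul, mul_assoc]

theorem pmfMean_map {β γ : Type*} [Fintype β] [Fintype γ] (P : PMF β) (g : β → γ)
    (f : γ → ℝ) : pmfMean (P.map g) f = pmfMean P (f ∘ g) := by
  rw [← PMF.bind_pure_comp, pmfMean_bind]
  simp [pmfMean_pure, Function.comp_def]

theorem pmfMean_const {β : Type*} [Fintype β] (P : PMF β) (c : ℝ) :
    pmfMean P (fun _ => c) = c := by
  have h := P.tsum_coe
  rw [tsum_fintype] at h
  rw [pmfMean, ← Finset.sum_mul, ← ENNReal.toReal_sum fun b _ => P.apply_ne_top b, h]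
  simp

/-- A probability mass function whose values at two distinct points add up to `1` is concentrated
on these points. -/
theorem pmfMean_of_pair {β : Type*} [Fintype β] (P : PMF β) {b c : β} (hbc : b ≠ c) {y : ℝ}
    (hb : (P b).toReal = y) (hc : (P c).toReal = 1 - y) (f : β → ℝ) :
    pmfMean P f = y * f b + (1 - y) * f c := by
  classical
  have h1 := pmfMean_const P 1
  have split : ∀ g : β → ℝ, pmfMean P g = (P b).toReal * g b + ((P c).toReal * g c +
      ∑ a ∈ (Finset.univ.erase b).erase c, (P a).toReal * g a) := fun g => by
    rw [pmfMean, Finset.add_sum_erase _ (fun a => (P a).toReal * g a) (by simp [hbc.symm]),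
      Finset.add_sum_erase _ (fun a => (P a).toReal * g a) (Finset.mem_univ b)]
  rw [split, hb, hc] at h1
  have h0 : ∑ a ∈ (Finset.univ.erase b).erase c, (P a).toReal * (1 : ℝ) = 0 := by linarith
  rw [Finset.sum_eq_zero_iff_of_nonneg fun a _ => by positivity] at h0
  rw [split, hb, hc, Finset.sum_eq_zero fun a ha => by rw [← mul_one (P a).toReal, h0 a ha, zero_mul]]
  ring

/-- The mean of a function of the round when the winner is drawn uniformly among the bidders. -/
noncomputable def drawMean {n : ℕ} (S : Finset (Fin n)) (f : Round n → ℝ) : ℝ :=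
  if S.Nonempty then (∑ j ∈ S, f (S, some j)) / S.card else f (S, none)

theorem pmfMean_winnerLaw {n : ℕ} (S : Finset (Fin n)) (f : Round n → ℝ) :
    pmfMean (winnerLaw S) (fun w => f (S, w)) = drawMean S f := by
  classical
  by_cases hS : S.Nonempty
  · rw [winnerLaw, dif_pos hS, pmfMean_map, drawMean, if_pos hS, pmfMean, div_eq_inv_mul,
      Finset.mul_sum, ← Finset.sum_subset (Finset.subset_univ S)]
    · refine Finset.sum_congr rfl fun j hj => ?_
      rw [PMF.uniformOfFinset_apply_of_mem hS hj]
      simp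
    · intro j _ hj
      rw [PMF.uniformOfFinset_apply_of_notMem hS hj]
      simp
  · rw [winnerLaw, dif_neg hS, pmfMean_pure, drawMean, if_neg hS]

theorem bidLaw_toReal {n : ℕ} (q : Fin n → I) (S : Finset (Fin n)) :
    (bidLaw q S).toReal = (∏ j ∈ S, (q j : ℝ)) * ∏ j ∈ Sᶜ, (1 - (q j : ℝ)) := by
  have h1 : ∀ j, (0 : ℝ) ≤ 1 - q j := fun j => sub_nonneg.2 (q j).2.2
  have h0 : ∀ j, (0 : ℝ) ≤ q j := fun j => (q j).2.1
  simp only [bidLaw, PMF.ofFintype_apply, ENNReal.toReal_mul, ENNReal.toReal_prod]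
  congr 1
  · exact Finset.prod_congr rfl fun j _ => ENNReal.toReal_ofReal (h0 j)
  · exact Finset.prod_congr rfl fun j _ => ENNReal.toReal_ofReal (h1 j)

/-- If everybody except agent `i` bids deterministically, the set of bidders is one of two. -/
theorem pmfMean_bidLaw {n : ℕ} (q : Fin n → I) (i : Fin n) (A : Finset (Fin n)) (hi : i ∉ A)
    (hA : ∀ j ∈ A, q j = 1) (hA' : ∀ j, j ≠ i → j ∉ A → q j = 0) (f : Finset (Fin n) → ℝ) :
    pmfMean (bidLaw q) f = (q i : ℝ) * f (insert i A) + (1 - (q i : ℝ)) * f A := by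
  refine pmfMean_of_pair _ (fun h : insert i A = A => hi (by
    rw [← h]; exact Finset.mem_insert_self i A)) ?_ ?_ f
  · rw [bidLaw_toReal, Finset.prod_insert hi, Finset.prod_eq_one fun j hj => by simp [hA j hj],
      Finset.prod_eq_one]
    · ring
    · intro j hj
      simp only [Finset.mem_compl, Finset.mem_insert, not_or] at hj
      simp [hA' j hj.1 hj.2]
  · have hi' : i ∈ Aᶜ := by simpa using hi
    rw [bidLaw_toReal, Finset.prod_eq_one fun j hj => by simp [hA j hj], ← Finset.mul_prod_erase _ _ hi',
      Finset.prod_eq_one]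
    · ring
    · intro j hj
      simp only [Finset.mem_erase, Finset.mem_compl] at hj
      simp [hA' j hj.1 hj.2]

/-! ### Deterministic coordinated bidding against one agent -/

/-- A coordinated deterministic plan of the opponents of agent `i`, in the mechanism with equal
shares, horizon `T` and payments `p`: given the record, exactly the agents in `act` bid. -/
structure Plan (n : ℕ) where
  /-- the number of rounds -/
  T : ℕ
  /-- the payment scheme -/
  p : ℕ → ℝ
  /-- the agent against whom the others bid -/
  i : Fin n
  /-- the opponents who bid after a given record -/
  act : (t : ℕ) → (Fin t → Round n) → Finset (Fin n)

namespace Plan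

variable {n : ℕ} (P : Plan n)

/-- The remaining budget of agent `j`. -/
noncomputable def rest {t : ℕ} (h : Fin t → Round n) (j : Fin n) : ℝ :=
  budget (fun _ => 1 / (n : ℝ)) P.T P.p h j

/-- Only opponents of `i` with a positive budget are asked to bid. -/
def Admissible : Prop :=
  ∀ (t : ℕ) (h : Fin t → Round n), P.i ∉ P.act t h ∧ ∀ j ∈ P.act t h, 0 < P.rest h j

/-- The strategy profile in which `i` plays `s` and the others follow the plan. -/
noncomputable def profile (s : Strategy n) : Fin n → Strategy n := fun j =>
  open Classical in
  if j = P.i then s else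
    { prob := fun t _ h => if j ∈ P.act t h then 1 else 0
      measurable_prob := fun _ _ => measurable_const }

/-- The mean over the next round, when `i` requests to bid with probability `x`. -/
noncomputable def stepMean (x : ℝ) {t : ℕ} (h : Fin t → Round n) (f : Round n → ℝ) : ℝ :=
  (if 0 < P.rest h P.i then x else 0) * drawMean (insert P.i (P.act t h)) f +
    (1 - if 0 < P.rest h P.i then x else 0) * drawMean (P.act t h) f

/-- The mean over the records of `t` rounds, when `i` requests to bid with probability `1/n`. -/
noncomputable def mean : (t : ℕ) → ((Fin t → Round n) → ℝ) → ℝ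
  | 0, f => f Fin.elim0
  | t + 1, f => mean t fun h => P.stepMean (1 / n) h fun r => f (Fin.snoc (α := fun _ => Round n) h r)

/-- The law of the record when `i` bids aggressively with the rule `ρ`. -/
noncomputable def law (ρ : ℝ → I) (hρ : Measurable ρ) (t : ℕ) (v : Fin t → Fin n → ℝ) :
    PMF (Fin t → Round n) :=
  recordLaw (fun _ => 1 / (n : ℝ)) P.T P.p (P.profile (aggressive n ρ hρ)) t v

variable {P} {ρ : ℝ → I} {hρ : Measurable ρ}

/-- The opponents are deterministic, so the current values enter only through the request
probability of `i`. This is the recursion behind all later computations with the law of the record.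
-/
theorem pmfMean_law_succ (hP : P.Admissible) (t : ℕ) (v : Fin (t + 1) → Fin n → ℝ)
    (f : (Fin (t + 1) → Round n) → ℝ) :
    pmfMean (P.law ρ hρ (t + 1) v) f = pmfMean (P.law ρ hρ t (Fin.init v)) fun h =>
      P.stepMean (ρ (v (Fin.last t) P.i)) h fun r =>
        f (Fin.snoc (α := fun _ => Round n) h r) := by
  rw [law, recordLaw, pmfMean_bind]
  refine congrArg (pmfMean _) (funext fun h => ?_)
  rw [pmfMean_bind]
  simp only [pmfMean_map, Function.comp_def]
  have key := fun S => pmfMean_winnerLaw S fun r => f (Fin.snoc (α := fun _ => Round n) h r)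
  simp only [key]
  rw [pmfMean_bidLaw _ P.i (P.act t h) (hP t h).1]
  · have hq : ((bidProb (fun _ => 1 / (n : ℝ)) P.T P.p (P.profile (aggressive n ρ hρ)) v h P.i : I) : ℝ)
        = if 0 < P.rest h P.i then (ρ (v (Fin.last t) P.i) : ℝ) else 0 := by
      rw [bidProb]
      change ((if P.rest h P.i ≤ 0 then _ else _ : I) : ℝ) = _
      by_cases hb : P.rest h P.i ≤ 0
      · rw [if_pos hb, if_neg hb.not_gt]; rfl
      · rw [if_neg hb, if_pos (not_le.1 hb)]
        simp [profile, aggressive]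
    rw [hq, stepMean]
  · intro j hj
    have hji : j ≠ P.i := fun e => (hP t h).1 (e ▸ hj)
    have := (hP t h).2 j hj
    rw [bidProb, if_neg (by exact this.not_ge)]
    simp [profile, hji, hj]
  · intro j hji hj
    rw [bidProb]
    simp [profile, hji, hj]

/-- Because of this form, averaging over the current value only replaces ρ(V) by its mean, which is
1/n. -/
theorem stepMean_affine (x : ℝ) {t : ℕ} (h : Fin t → Round n) (f : Round n → ℝ) :
    P.stepMean x h f = x * (P.stepMean 1 h f - P.stepMean 0 h f) + P.stepMean 0 h f := by
  unfold stepMean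
  split_ifs <;> ring

theorem drawMean_add (S : Finset (Fin n)) (f g : Round n → ℝ) :
    drawMean S (fun r => f r + g r) = drawMean S f + drawMean S g := by
  unfold drawMean
  split_ifs
  · rw [Finset.sum_add_distrib, add_div]
  · rfl

theorem drawMean_mul (S : Finset (Fin n)) (c : ℝ) (f : Round n → ℝ) :
    drawMean S (fun r => c * f r) = c * drawMean S f := by
  unfold drawMean
  split_ifs
  · rw [← Finset.mul_sum, mul_div_assoc]
  · rfl

theorem drawMean_const (S : Finset (Fin n)) (c : ℝ) : drawMean S (fun _ => c) = c := by
  unfold drawMean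
  split_ifs with hS
  · have : (S.card : ℝ) ≠ 0 := by exact_mod_cast hS.card_pos.ne'
    simp [this]
  · rfl

theorem stepMean_add (x : ℝ) {t : ℕ} (h : Fin t → Round n) (f g : Round n → ℝ) :
    P.stepMean x h (fun r => f r + g r) = P.stepMean x h f + P.stepMean x h g := by
  simp only [stepMean, drawMean_add]; ring

theorem stepMean_mul (x : ℝ) {t : ℕ} (h : Fin t → Round n) (c : ℝ) (f : Round n → ℝ) :
    P.stepMean x h (fun r => c * f r) = c * P.stepMean x h f := by
  simp only [stepMean, drawMean_mul]; ring

theorem stepMean_const (x : ℝ) {t : ℕ} (h : Fin t → Round n) (c : ℝ) :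
    P.stepMean x h (fun _ => c) = c := by
  simp only [stepMean, drawMean_const]; ring

theorem mean_add (t : ℕ) (f g : (Fin t → Round n) → ℝ) :
    P.mean t (fun h => f h + g h) = P.mean t f + P.mean t g := by
  induction t with
  | zero => rfl
  | succ t ih => simp only [mean, stepMean_add, ih]

theorem mean_mul (t : ℕ) (c : ℝ) (f : (Fin t → Round n) → ℝ) :
    P.mean t (fun h => c * f h) = c * P.mean t f := by
  induction t with
  | zero => rfl
  | succ t ih => simp only [mean, stepMean_mul, ih]

theorem mean_const (t : ℕ) (c : ℝ) : P.mean t (fun _ => c) = c := by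
  induction t with
  | zero => rfl
  | succ t ih => simp only [mean, stepMean_const, ih]

theorem mean_init (t : ℕ) (f : (Fin t → Round n) → ℝ) :
    P.mean (t + 1) (fun h => f (Fin.init h)) = P.mean t f := by
  simp only [mean, Fin.init_snoc, stepMean_const]

end Plan

/-! ### Integrating out the values -/

/-- Fubini for splitting off the last round: its values are independent of everything before. -/
theorem integral_init_mul_last {X : Type*} [MeasurableSpace X] (μ : Measure X)
    [IsProbabilityMeasure μ] (t : ℕ) (u : (Fin t → X) → ℝ) (g : X → ℝ) :
    ∫ v : Fin (t + 1) → X, u (Fin.init v) * g (v (Fin.last t)) ∂(Measure.pi fun _ => μ) =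
      (∫ v, u v ∂(Measure.pi fun _ => μ)) * ∫ x, g x ∂μ := by
  have h := measurePreserving_piFinSuccAbove (fun _ : Fin (t + 1) => μ) (Fin.last t)
  have h2 := h.integral_comp (MeasurableEquiv.measurableEmbedding _)
    (fun z : X × (Fin t → X) => g z.1 * u z.2)
  have e : ∀ v : Fin (t + 1) → X,
      MeasurableEquiv.piFinSuccAbove (fun _ => X) (Fin.last t) v = (v (Fin.last t), Fin.init v) := by
    intro v
    simp [MeasurableEquiv.piFinSuccAbove, Fin.insertNthEquiv, Fin.init_def]
  simp only [e] at h2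
  rw [integral_prod_mul] at h2
  simp only [mul_comm (u _), mul_comm (∫ v, u v ∂_)]
  exact h2

namespace Plan

variable {n : ℕ} {P : Plan n} {ρ : ℝ → I} {hρ : Measurable ρ}

/-- Turns a point mass into an expectation, so that the recursion for expectations also yields
measurability in the values. -/
theorem law_toReal_eq_pmfMean (t : ℕ) (v : Fin t → Fin n → ℝ) (h : Fin t → Round n) :
    (P.law ρ hρ t v h).toReal = pmfMean (P.law ρ hρ t v) fun h' => open Classical in
      if h' = h then 1 else 0 := by
  simp [pmfMean]

theorem measurable_law (hP : P.Admissible) (t : ℕ) (h : Fin t → Round n) :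
    Measurable fun v => (P.law ρ hρ t v h).toReal := by
  induction t with
  | zero =>
    have : (fun v => (P.law ρ hρ 0 v h).toReal) = fun _ => (P.law ρ hρ 0 Fin.elim0 h).toReal := by
      funext v; rw [Subsingleton.elim v Fin.elim0]
    rw [this]; exact measurable_const
  | succ t ih =>
    simp only [law_toReal_eq_pmfMean, pmfMean_law_succ hP]
    simp only [pmfMean]
    refine Finset.measurable_sum _ fun h' _ => Measurable.mul ?_ ?_
    · refine (ih h').comp ?_
      exact measurable_pi_lambda _ fun s => measurable_pi_apply _
    · simp only [stepMean_affine (ρ _ : ℝ)]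
      refine Measurable.add_const (Measurable.mul_const ?_ _) _
      exact (measurable_subtype_coe.comp hρ).comp
        ((measurable_pi_apply P.i).comp (measurable_pi_apply (Fin.last t)))

theorem law_toReal_le_one (t : ℕ) (v : Fin t → Fin n → ℝ) (h : Fin t → Round n) :
    (P.law ρ hρ t v h).toReal ≤ 1 :=
  ENNReal.toReal_le_of_le_ofReal zero_le_one (by simpa using PMF.coe_le_one _ _)

variable {F : Fin n → Measure ℝ} [∀ j, IsProbabilityMeasure (F j)]

theorem integrable_law (hP : P.Admissible) (t : ℕ) (h : Fin t → Round n) :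
    Integrable (fun v => (P.law ρ hρ t v h).toReal)
      (Measure.pi fun _ : Fin t => Measure.pi F) := by
  refine Integrable.of_bound (measurable_law hP t h).aestronglyMeasurable 1 (.of_forall fun v => ?_)
  rw [Real.norm_of_nonneg ENNReal.toReal_nonneg]
  exact law_toReal_le_one t v h

theorem integrable_rule (hρ : Measurable ρ) (j : Fin n) :
    Integrable (fun x => (ρ x : ℝ)) (F j) := by
  refine Integrable.of_bound (measurable_subtype_coe.comp hρ).aestronglyMeasurable 1
    (.of_forall fun x => ?_)
  rw [Real.norm_of_nonneg (ρ x).2.1]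
  exact (ρ x).2.2

theorem integral_last (t : ℕ) (u : (Fin t → Fin n → ℝ) → ℝ) (j : Fin n) (g : ℝ → ℝ)
    (hg : AEStronglyMeasurable g (F j)) :
    ∫ v : Fin (t + 1) → Fin n → ℝ, u (Fin.init v) * g (v (Fin.last t) j)
        ∂(Measure.pi fun _ => Measure.pi F) =
      (∫ v, u v ∂(Measure.pi fun _ => Measure.pi F)) * ∫ x, g x ∂(F j) := by
  rw [integral_init_mul_last (Measure.pi F) t u fun y => g (y j)]
  congr 1
  have h := measurePreserving_eval F j
  have h2 := integral_map (f := g) h.measurable.aemeasurable (by rw [h.map_eq]; exact hg)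
  rw [h.map_eq] at h2
  exact h2.symm

theorem integrable_last (t : ℕ) (u : (Fin t → Fin n → ℝ) → ℝ) (j : Fin n) (g : ℝ → ℝ)
    (hu : Integrable u (Measure.pi fun _ => Measure.pi F)) (hg : Integrable g (F j)) :
    Integrable (fun v : Fin (t + 1) → Fin n → ℝ => u (Fin.init v) * g (v (Fin.last t) j))
      (Measure.pi fun _ => Measure.pi F) := by
  have h := measurePreserving_piFinSuccAbove (fun _ : Fin (t + 1) => Measure.pi F) (Fin.last t)
  have h1 : Integrable (fun y : Fin n → ℝ => g (y j)) (Measure.pi F) :=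
    (measurePreserving_eval F j).integrable_comp_of_integrable hg
  have h2 := h.integrable_comp_of_integrable (h1.mul_prod hu)
  refine h2.congr (.of_forall fun v => ?_)
  simp only [MeasurableEquiv.piFinSuccAbove, Fin.insertNthEquiv, Function.comp_apply]
  rw [mul_comm]
  simp [Fin.init_def]

theorem integral_init (t : ℕ) (u : (Fin t → Fin n → ℝ) → ℝ) :
    ∫ v : Fin (t + 1) → Fin n → ℝ, u (Fin.init v) ∂(Measure.pi fun _ => Measure.pi F) =
      ∫ v, u v ∂(Measure.pi fun _ => Measure.pi F) := by
  simpa using integral_init_mul_last (Measure.pi F) t u fun _ => 1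

/-- The record has the same law as if `i` requested to bid with probability `1/n` in every round. -/
theorem integral_pmfMean_law (hP : P.Admissible) (hm : ∫ x, (ρ x : ℝ) ∂(F P.i) = 1 / n) (t : ℕ)
    (f : (Fin t → Round n) → ℝ) :
    ∫ v, pmfMean (P.law ρ hρ t v) f ∂(Measure.pi fun _ : Fin t => Measure.pi F) = P.mean t f := by
  induction t with
  | zero =>
    have : ∀ v, pmfMean (P.law ρ hρ 0 v) f = f Fin.elim0 := fun v => by
      rw [law, recordLaw, pmfMean_pure]
    simp [this, mean]
  | succ t ih =>
    simp only [pmfMean_law_succ hP]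
    rw [mean, ← ih]
    simp only [pmfMean]
    have hI := integrable_rule (F := F) hρ P.i
    rw [integral_finsetSum, integral_finsetSum]
    · refine Finset.sum_congr rfl fun h _ => ?_
      rw [integral_last t (fun v => (P.law ρ hρ t v h).toReal) P.i
        (fun x => P.stepMean (ρ x) h fun r => f (Fin.snoc (α := fun _ => Round n) h r)),
        integral_mul_const]
      · congr 1
        simp only [stepMean_affine (ρ _ : ℝ)]
        rw [integral_add (hI.mul_const _) (integrable_const _), integral_mul_const, hm]
        rw [stepMean_affine (1 / (n : ℝ))]
        simp
      · simp only [stepMean_affine (ρ _ : ℝ)]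
        exact ((hI.mul_const _).add (integrable_const _)).aestronglyMeasurable
    · exact fun h _ => (integrable_law hP t h).mul_const _
    · intro h _
      refine integrable_last t (fun v => (P.law ρ hρ t v h).toReal) P.i
        (fun x => P.stepMean (ρ x) h fun r => f (Fin.snoc (α := fun _ => Round n) h r))
        (integrable_law hP t h) ?_
      simp only [stepMean_affine (ρ _ : ℝ)]
      exact (hI.mul_const _).add (integrable_const _)

/-! ### Reduction of the expected utility to the expected number of wins -/

/-- The total of a quantity that depends on the round and on the record of the earlier rounds. -/
def total {R : Type*} (g : (t : ℕ) → (Fin t → R) → R → ℝ) : (t : ℕ) → (Fin t → R) → ℝ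
  | 0, _ => 0
  | t + 1, h => total g t (Fin.init h) + g t (Fin.init h) (h (Fin.last t))

theorem total_snoc {R : Type*} (g : (t : ℕ) → (Fin t → R) → R → ℝ) (t : ℕ) (h : Fin t → R)
    (r : R) : total g (t + 1) (Fin.snoc (α := fun _ => R) h r) = total g t h + g t h r := by
  simp [total]

/-- The number of rounds won by agent `j`. -/
noncomputable def wins (j : Fin n) : (t : ℕ) → (Fin t → Round n) → ℝ :=
  total fun _ _ r => if r.2 = some j then 1 else 0

theorem stepMean_win (hP : P.Admissible) (x : ℝ) {t : ℕ} (h : Fin t → Round n) :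
    P.stepMean x h (fun r => if r.2 = some P.i then 1 else 0) =
      x * ((if 0 < P.rest h P.i then 1 else 0) / ((P.act t h).card + 1)) := by
  have hi := (hP t h).1
  have h1 : drawMean (P.act t h) (fun r => if r.2 = some P.i then (1 : ℝ) else 0) = 0 := by
    rw [drawMean]
    split_ifs with hS hn
    · rw [Finset.sum_eq_zero, zero_div]
      intro j hj
      have : j ≠ P.i := fun e => hi (e ▸ hj)
      simp [this]
    · exact absurd hn (by simp)
    · rfl
  have h2 : drawMean (insert P.i (P.act t h)) (fun r => if r.2 = some P.i then (1 : ℝ) else 0) =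
      1 / ((P.act t h).card + 1) := by
    rw [drawMean, if_pos (Finset.insert_nonempty _ _), Finset.card_insert_of_notMem hi]
    simp
  rw [stepMean, h1, h2]
  split_ifs <;> ring

/-- In each round the current value is independent of the past record, and winning depends on it
only through the request. The round thus contributes E[Vρ(V)] times the probability of winning given
a request, and the unconditional win probability is 1/n times the latter; this is the origin of the
factor n. Integrability is carried along in the induction because the integral of the sum has to be
split. -/
theorem integral_utility (hP : P.Admissible) (hm : ∫ x, (ρ x : ℝ) ∂(F P.i) = 1 / n)
    (hV : ∀ᵐ x ∂(F P.i), x ∈ Set.Icc (0 : ℝ) 1) (t : ℕ) :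
    Integrable (fun v => pmfMean (P.law ρ hρ t v) fun h =>
        ∑ s : Fin t, if (h s).2 = some P.i then v s P.i else 0)
      (Measure.pi fun _ : Fin t => Measure.pi F) ∧
    ∫ v, pmfMean (P.law ρ hρ t v) (fun h =>
        ∑ s : Fin t, if (h s).2 = some P.i then v s P.i else 0)
      ∂(Measure.pi fun _ : Fin t => Measure.pi F) =
    (∫ x, x * (ρ x : ℝ) ∂(F P.i)) * (n * P.mean t (wins P.i t)) := by
  have hn : (n : ℝ) ≠ 0 := by exact_mod_cast (Fin.pos P.i).ne'
  have hI : Integrable (fun x => x * (ρ x : ℝ)) (F P.i) := by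
    refine Integrable.of_bound
      (measurable_id.mul (measurable_subtype_coe.comp hρ)).aestronglyMeasurable 1 ?_
    filter_upwards [hV] with x hx
    rw [Real.norm_of_nonneg (mul_nonneg hx.1 (ρ x).2.1)]
    exact mul_le_one₀ hx.2 (ρ x).2.1 (ρ x).2.2
  induction t with
  | zero =>
    have : ∀ v, pmfMean (P.law ρ hρ 0 v) (fun h =>
        ∑ s : Fin 0, if (h s).2 = some P.i then v s P.i else 0) = 0 := fun v => by
      simp [pmfMean]
    simp only [this, mean, wins, total]
    simp
  | succ t ih =>
    have step : ∀ v : Fin (t + 1) → Fin n → ℝ, pmfMean (P.law ρ hρ (t + 1) v) (fun h =>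
        ∑ s : Fin (t + 1), if (h s).2 = some P.i then v s P.i else 0) =
        pmfMean (P.law ρ hρ t (Fin.init v)) (fun h =>
          ∑ s : Fin t, if (h s).2 = some P.i then Fin.init v s P.i else 0) +
        ∑ h, (P.law ρ hρ t (Fin.init v) h).toReal * (v (Fin.last t) P.i * ρ (v (Fin.last t) P.i)) *
          ((if 0 < P.rest h P.i then 1 else 0) / ((P.act t h).card + 1)) := by
      intro v
      rw [pmfMean_law_succ hP]
      simp only [pmfMean]
      rw [← Finset.sum_add_distrib]
      refine Finset.sum_congr rfl fun h _ => ?_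
      have e1 : ∀ r : Round n, (∑ s : Fin (t + 1),
          if ((Fin.snoc (α := fun _ => Round n) h r : Fin (t + 1) → Round n) s).2 = some P.i
            then v s P.i else 0) =
          (∑ s : Fin t, if (h s).2 = some P.i then Fin.init v s P.i else 0) +
            v (Fin.last t) P.i * (if r.2 = some P.i then 1 else 0) := fun r => by
        rw [Fin.sum_univ_castSucc]
        simp [Fin.init]
      simp only [e1]
      rw [stepMean_add, stepMean_const, stepMean_mul, stepMean_win hP]
      ring
    have hIh : ∀ h, Integrable (fun v : Fin (t + 1) → Fin n → ℝ =>
        (P.law ρ hρ t (Fin.init v) h).toReal * (v (Fin.last t) P.i * ρ (v (Fin.last t) P.i)))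
        (Measure.pi fun _ => Measure.pi F) := fun h =>
      integrable_last t (fun v => (P.law ρ hρ t v h).toReal) P.i (fun x => x * (ρ x : ℝ))
        (integrable_law hP t h) hI
    have hI1 : Integrable (fun v : Fin (t + 1) → Fin n → ℝ =>
        pmfMean (P.law ρ hρ t (Fin.init v)) (fun h =>
          ∑ s : Fin t, if (h s).2 = some P.i then Fin.init v s P.i else 0))
        (Measure.pi fun _ => Measure.pi F) := by
      simpa using integrable_last t (fun v => pmfMean (P.law ρ hρ t v) (fun h =>
          ∑ s : Fin t, if (h s).2 = some P.i then v s P.i else 0)) P.i (fun _ => 1) ih.1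
          (integrable_const _)
    have hI2 := integrable_finsetSum Finset.univ fun h _ => (hIh h).mul_const
      ((if 0 < P.rest h P.i then (1 : ℝ) else 0) / ((P.act t h).card + 1))
    simp only [step]
    refine ⟨hI1.add hI2, ?_⟩
    rw [integral_add hI1 hI2, integral_init t fun v => pmfMean (P.law ρ hρ t v) (fun h =>
          ∑ s : Fin t, if (h s).2 = some P.i then v s P.i else 0), ih.2,
      integral_finsetSum _ fun h _ => (hIh h).mul_const _]
    simp only [integral_mul_const]
    have e2 : ∀ h, ∫ v : Fin (t + 1) → Fin n → ℝ,
        (P.law ρ hρ t (Fin.init v) h).toReal * (v (Fin.last t) P.i * ρ (v (Fin.last t) P.i))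
        ∂(Measure.pi fun _ => Measure.pi F) =
        (∫ v, (P.law ρ hρ t v h).toReal ∂(Measure.pi fun _ => Measure.pi F)) *
          ∫ x, x * (ρ x : ℝ) ∂(F P.i) := fun h =>
      integral_last t (fun v => (P.law ρ hρ t v h).toReal) P.i (fun x => x * (ρ x : ℝ))
        hI.aestronglyMeasurable
    simp only [e2]
    have e3 := integral_pmfMean_law (F := F) (hρ := hρ) hP hm t fun h =>
      (if 0 < P.rest h P.i then (1 : ℝ) else 0) / ((P.act t h).card + 1)
    simp only [pmfMean] at e3
    rw [integral_finsetSum _ fun h _ => (integrable_law hP t h).mul_const _] at e3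
    simp only [integral_mul_const] at e3
    have e4 : P.mean (t + 1) (wins P.i (t + 1)) = P.mean t (wins P.i t) +
        1 / n * P.mean t fun h =>
          (if 0 < P.rest h P.i then (1 : ℝ) else 0) / ((P.act t h).card + 1) := by
      rw [mean]
      simp only [wins, total_snoc, stepMean_add, stepMean_const, stepMean_win hP, mean_add, mean_mul]
    rw [e4, ← e3, mul_add, mul_add, ← mul_assoc (n : ℝ) (1 / n), mul_one_div_cancel hn, one_mul,
      Finset.mul_sum]
    congr 1
    exact Finset.sum_congr rfl fun h _ => by ring

/-- Against a coordinated deterministic plan, the aggressive agent obtains the fraction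
`n E[#wins] / T` of her ideal utility. -/
theorem expectedUtility_eq (hP : P.Admissible) (hm : ∫ x, (ρ x : ℝ) ∂(F P.i) = 1 / n)
    (hV : ∀ᵐ x ∂(F P.i), x ∈ Set.Icc (0 : ℝ) 1) :
    expectedUtility (fun _ => 1 / (n : ℝ)) P.T P.p F (P.profile (aggressive n ρ hρ)) P.i =
      (∫ x, x * (ρ x : ℝ) ∂(F P.i)) * (n * P.mean P.T (wins P.i P.T) / P.T) := by
  have h := (integral_utility (hρ := hρ) hP hm hV P.T).2
  have e : ∀ v : Fin P.T → Fin n → ℝ, (∑ h : Fin P.T → Round n,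
      (recordLaw (fun _ => 1 / (n : ℝ)) P.T P.p (P.profile (aggressive n ρ hρ)) P.T v h).toReal *
        averageUtility P.i v h) = 1 / (P.T : ℝ) * pmfMean (P.law ρ hρ P.T v) (fun h =>
        ∑ s : Fin P.T, if (h s).2 = some P.i then v s P.i else 0) := fun v => by
    rw [pmfMean, Finset.mul_sum]
    exact Finset.sum_congr rfl fun h _ => by rw [averageUtility, law]; ring
  rw [expectedUtility]
  simp only [e]
  rw [integral_const_mul, h]
  ring

end Plan

namespace Plan

variable {n : ℕ} {P : Plan n}

/-! ### Reachable records -/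

/-- The rounds that can follow the record `h`. -/
def Follows (P : Plan n) {t : ℕ} (h : Fin t → Round n) (r : Round n) : Prop :=
  r = (P.act t h, none) ∨ (∃ j ∈ P.act t h, r = (P.act t h, some j)) ∨
    (0 < P.rest h P.i ∧ ∃ j ∈ insert P.i (P.act t h), r = (insert P.i (P.act t h), some j))

/-- The records that can occur under the plan. -/
def Reachable (P : Plan n) : (t : ℕ) → (Fin t → Round n) → Prop
  | 0, _ => True
  | t + 1, h => P.Reachable t (Fin.init h) ∧ P.Follows (Fin.init h) (h (Fin.last t))

theorem drawMean_mono {S : Finset (Fin n)} {f g : Round n → ℝ}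
    (h0 : f (S, none) ≤ g (S, none)) (h1 : ∀ j ∈ S, f (S, some j) ≤ g (S, some j)) :
    drawMean S f ≤ drawMean S g := by
  unfold drawMean
  split_ifs
  · exact div_le_div_of_nonneg_right (Finset.sum_le_sum h1) (Nat.cast_nonneg _)
  · exact h0

theorem stepMean_mono {x : ℝ} (hx0 : 0 ≤ x) (hx1 : x ≤ 1) {t : ℕ} {h : Fin t → Round n}
    {f g : Round n → ℝ} (hfg : ∀ r, P.Follows h r → f r ≤ g r) :
    P.stepMean x h f ≤ P.stepMean x h g := by
  have h2 : drawMean (P.act t h) f ≤ drawMean (P.act t h) g :=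
    drawMean_mono (hfg _ (Or.inl rfl)) fun j hj => hfg _ (Or.inr (Or.inl ⟨j, hj, rfl⟩))
  unfold stepMean
  split_ifs with hr
  · have h1 : drawMean (insert P.i (P.act t h)) f ≤ drawMean (insert P.i (P.act t h)) g := by
      rw [drawMean, drawMean, if_pos (Finset.insert_nonempty _ _),
        if_pos (Finset.insert_nonempty _ _)]
      exact div_le_div_of_nonneg_right (Finset.sum_le_sum fun j hj =>
        hfg _ (Or.inr (Or.inr ⟨hr, j, hj, rfl⟩))) (Nat.cast_nonneg _)
    exact add_le_add (mul_le_mul_of_nonneg_left h1 hx0)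
      (mul_le_mul_of_nonneg_left h2 (sub_nonneg.2 hx1))
  · simpa using h2

theorem one_div_natCast_le_one (n : ℕ) : 1 / (n : ℝ) ≤ 1 := by
  rcases Nat.eq_zero_or_pos n with rfl | hn
  · simp
  · exact (div_le_one (by positivity)).2 (by exact_mod_cast hn)

theorem mean_mono {t : ℕ} {f g : (Fin t → Round n) → ℝ}
    (hfg : ∀ h, P.Reachable t h → f h ≤ g h) : P.mean t f ≤ P.mean t g := by
  induction t with
  | zero => exact hfg _ trivial
  | succ t ih =>
    refine ih fun h hh => stepMean_mono (by positivity) (one_div_natCast_le_one n) fun r hr => hfg _ ?_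
    exact ⟨by simpa using hh, by simpa using hr⟩

theorem mean_nonneg {t : ℕ} {f : (Fin t → Round n) → ℝ} (hf : ∀ h, 0 ≤ f h) :
    0 ≤ P.mean t f := by
  rw [← mean_const (P := P) t 0]; exact mean_mono fun h _ => hf h

theorem mean_le_of_le {t : ℕ} {f : (Fin t → Round n) → ℝ} {c : ℝ}
    (hf : ∀ h, P.Reachable t h → f h ≤ c) : P.mean t f ≤ c := by
  rw [← mean_const (P := P) t c]; exact mean_mono hf

theorem mean_total (g : (t : ℕ) → (Fin t → Round n) → Round n → ℝ) (t : ℕ) :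
    P.mean t (total g t) =
      ∑ s ∈ Finset.range t, P.mean s fun h => P.stepMean (1 / n) h (g s h) := by
  induction t with
  | zero => rfl
  | succ t ih =>
    rw [mean, Finset.sum_range_succ, ← ih, ← mean_add]
    simp only [total_snoc, stepMean_add, stepMean_const]

/-! ### Means over one round -/

/-- The indicator that agent `i` has not exhausted her budget. -/
noncomputable def alive (P : Plan n) {t : ℕ} (h : Fin t → Round n) : ℝ :=
  if 0 < P.rest h P.i then 1 else 0

theorem stepMean_own (hP : P.Admissible) (x : ℝ) {t : ℕ} (h : Fin t → Round n) (φ : ℕ → ℝ) :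
    P.stepMean x h (fun r => if r.2 = some P.i then φ r.1.card else 0) =
      x * (P.alive h * (φ ((P.act t h).card + 1) / ((P.act t h).card + 1))) := by
  have hi := (hP t h).1
  have h1 : drawMean (P.act t h) (fun r => if r.2 = some P.i then φ r.1.card else 0) = 0 := by
    rw [drawMean]
    split_ifs with hS hn
    · rw [Finset.sum_eq_zero, zero_div]
      intro j hj
      have : j ≠ P.i := fun e => hi (e ▸ hj)
      simp [this]
    · exact absurd hn (by simp)
    · rfl
  have h2 : drawMean (insert P.i (P.act t h)) (fun r => if r.2 = some P.i then φ r.1.card else 0) =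
      φ ((P.act t h).card + 1) / ((P.act t h).card + 1) := by
    rw [drawMean, if_pos (Finset.insert_nonempty _ _), Finset.card_insert_of_notMem hi]
    simp [Finset.card_insert_of_notMem hi]
  rw [stepMean, h1, h2, alive]
  split_ifs <;> ring

theorem stepMean_lost (hP : P.Admissible) (x : ℝ) {t : ℕ} (h : Fin t → Round n) :
    P.stepMean x h (fun r => if P.i ∈ r.1 ∧ r.2 ≠ some P.i then 1 else 0) =
      x * (P.alive h * ((P.act t h).card / ((P.act t h).card + 1))) := by
  have hi := (hP t h).1
  have h1 : drawMean (P.act t h) (fun r => if P.i ∈ r.1 ∧ r.2 ≠ some P.i then (1 : ℝ) else 0) = 0 := by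
    simp [drawMean, hi]
  have h2 : drawMean (insert P.i (P.act t h))
      (fun r => if P.i ∈ r.1 ∧ r.2 ≠ some P.i then (1 : ℝ) else 0) =
      (P.act t h).card / ((P.act t h).card + 1) := by
    rw [drawMean, if_pos (Finset.insert_nonempty _ _), Finset.card_insert_of_notMem hi,
      Finset.sum_insert hi]
    rw [Finset.sum_congr rfl (g := fun _ => (1 : ℝ))]
    · simp
    · intro j hj
      have : j ≠ P.i := fun e => hi (e ▸ hj)
      simp [this]
  rw [stepMean, h1, h2, alive]
  split_ifs <;> ring

/-! ### Budgets along a record -/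

theorem rest_zero (h : Fin 0 → Round n) (j : Fin n) : P.rest h j = P.T / n := by
  simp [rest, budget]; ring

theorem rest_snoc {t : ℕ} (h : Fin t → Round n) (r : Round n) (j : Fin n) :
    P.rest (Fin.snoc (α := fun _ => Round n) h r : Fin (t + 1) → Round n) j =
      P.rest h j - payment P.p r j := by
  simp only [rest, budget, Fin.sum_univ_castSucc, Fin.snoc_castSucc, Fin.snoc_last]
  ring

theorem payment_nonneg {p : ℕ → ℝ} (hp : ∀ k, 0 ≤ p k) (r : Round n) (j : Fin n) :
    0 ≤ payment p r j := by
  unfold payment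
  split_ifs
  · exact hp _
  · exact le_rfl

theorem rest_succ {t : ℕ} (h : Fin (t + 1) → Round n) (j : Fin n) :
    P.rest h j = P.rest (Fin.init h) j - payment P.p (h (Fin.last t)) j := by
  conv_lhs => rw [← Fin.snoc_init_self h]
  exact rest_snoc _ _ _

theorem rest_le (hp : ∀ k, 0 ≤ P.p k) {t : ℕ} (h : Fin t → Round n) (j : Fin n) :
    P.rest h j ≤ P.T / n := by
  induction t with
  | zero => rw [rest_zero]
  | succ t ih =>
    rw [rest_succ]
    linarith [ih (Fin.init h), payment_nonneg hp (h (Fin.last t)) j]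

theorem alive_nonneg {t : ℕ} (h : Fin t → Round n) : 0 ≤ P.alive h := by
  unfold alive; split_ifs <;> norm_num

theorem alive_le_one {t : ℕ} (h : Fin t → Round n) : P.alive h ≤ 1 := by
  unfold alive; split_ifs <;> norm_num

/-- The probability that agent `i` has not exhausted her budget before round `t`. -/
noncomputable def aliveProb (P : Plan n) (t : ℕ) : ℝ := P.mean t P.alive

theorem aliveProb_nonneg (t : ℕ) : 0 ≤ P.aliveProb t := mean_nonneg alive_nonneg

theorem aliveProb_le_one (t : ℕ) : P.aliveProb t ≤ 1 := mean_le_of_le fun h _ => alive_le_one h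

theorem antitone_aliveProb (hp : ∀ k, 0 ≤ P.p k) : Antitone P.aliveProb := by
  refine antitone_nat_of_succ_le fun t => ?_
  rw [aliveProb, aliveProb, ← mean_init t P.alive]
  refine mean_mono fun h _ => ?_
  unfold alive
  have h1 := rest_succ (P := P) h P.i
  have h2 := payment_nonneg hp (h (Fin.last t)) P.i
  split_ifs with h3 h4
  · exact le_rfl
  · exact absurd (by linarith) h4
  · exact zero_le_one
  · exact le_rfl

/-- The opponents of `i` who have not exhausted their budgets. -/
noncomputable def solvent (P : Plan n) {t : ℕ} (h : Fin t → Round n) : Finset (Fin n) :=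
  open Classical in Finset.univ.filter fun j => j ≠ P.i ∧ 0 < P.rest h j

theorem mem_solvent {t : ℕ} {h : Fin t → Round n} {j : Fin n} :
    j ∈ P.solvent h ↔ j ≠ P.i ∧ 0 < P.rest h j := by
  simp [solvent]

theorem solvent_succ_subset (hp : ∀ k, 0 ≤ P.p k) {t : ℕ} (h : Fin (t + 1) → Round n) :
    P.solvent h ⊆ P.solvent (Fin.init h) := by
  intro j hj
  rw [mem_solvent] at hj ⊢
  rw [rest_succ] at hj
  exact ⟨hj.1, by linarith [hj.2, payment_nonneg hp (h (Fin.last t)) j]⟩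

/-! ### Blocking plans -/

/-- In the rounds `t` with `S t < S (t + 1)`, `k` solvent opponents bid as long as there are so
many; no opponent bids in the other rounds. -/
structure Blocking (P : Plan n) (k : ℕ) (S : ℕ → ℕ) : Prop where
  admissible : P.Admissible
  card_act : ∀ (t : ℕ) (h : Fin t → Round n),
    (P.act t h).card = if S t < S (t + 1) ∧ k ≤ (P.solvent h).card then k else 0

/-- Solvency depends only on the horizon, the payments and the record, not on the plan. It can
therefore be evaluated for a dummy plan `P₀` before the bidders are chosen. -/
theorem exists_blocking (T : ℕ) (p : ℕ → ℝ) (i : Fin n) (k : ℕ) (S : ℕ → ℕ) :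
    ∃ P : Plan n, P.T = T ∧ P.p = p ∧ P.i = i ∧ P.Blocking k S := by
  classical
  let P₀ : Plan n := ⟨T, p, i, fun _ _ => ∅⟩
  have hex : ∀ (t : ℕ) (h : Fin t → Round n), ∃ A ⊆ P₀.solvent h,
      A.card = if S t < S (t + 1) ∧ k ≤ (P₀.solvent h).card then k else 0 := by
    intro t h
    split_ifs with hk
    · exact Finset.exists_subset_card_eq hk.2
    · exact ⟨∅, by simp, rfl⟩
  choose A hA hcard using hex
  exact ⟨⟨T, p, i, A⟩, rfl, rfl, rfl, fun t h => ⟨fun hi => (mem_solvent.1 (hA t h hi)).1 rfl,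
    fun j hj => (mem_solvent.1 (hA t h hj)).2⟩, hcard⟩

/-- `S` counts the rounds of a set: it increases by at most `1` in every round. -/
structure IsSchedule (S : ℕ → ℕ) : Prop where
  zero : S 0 = 0
  succ : ∀ t, S (t + 1) = S t ∨ S (t + 1) = S t + 1

theorem IsSchedule.monotone {S : ℕ → ℕ} (hS : IsSchedule S) : Monotone S :=
  monotone_nat_of_le_succ fun t => by rcases hS.succ t with h | h <;> omega

/-- The indicator that fewer than `k` opponents have not exhausted their budgets. -/
noncomputable def failing (P : Plan n) (k : ℕ) {t : ℕ} (h : Fin t → Round n) : ℝ :=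
  if k ≤ (P.solvent h).card then 0 else 1

theorem failing_nonneg (k : ℕ) {t : ℕ} (h : Fin t → Round n) : 0 ≤ P.failing k h := by
  unfold failing; split_ifs <;> norm_num

/-- The probability that before round `t` the opponents fail and `i` does not. -/
noncomputable def failProb (P : Plan n) (k t : ℕ) : ℝ :=
  P.mean t fun h => P.alive h * P.failing k h

theorem failProb_nonneg (k t : ℕ) : 0 ≤ P.failProb k t :=
  mean_nonneg fun h => mul_nonneg (alive_nonneg h) (failing_nonneg k h)

variable {k : ℕ} {S : ℕ → ℕ}

theorem natCast_mul_one_div (i : Fin n) (y : ℝ) : (n : ℝ) * (1 / n * y) = y := by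
  have hn : (n : ℝ) ≠ 0 := by exact_mod_cast (Fin.pos i).ne'
  field_simp

/-- The number of wins of `i`, bounded through the survival and failure probabilities. -/
theorem mean_wins_le (hB : P.Blocking k S) (hS : IsSchedule S) (T : ℕ) :
    n * P.mean T (wins P.i T) ≤ ∑ t ∈ Finset.range T,
      ((1 - ((S (t + 1) : ℝ) - S t) * (k / (k + 1))) * P.aliveProb t +
        ((S (t + 1) : ℝ) - S t) * (k / (k + 1)) * P.failProb k t) := by
  rw [wins, mean_total, Finset.mul_sum]
  refine Finset.sum_le_sum fun t _ => ?_
  have e : ∀ h : Fin t → Round n, P.stepMean (1 / n) h (fun r => if r.2 = some P.i then 1 else 0) =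
      1 / n * (P.alive h * (1 / ((P.act t h).card + 1))) := fun h =>
    stepMean_own hB.admissible _ h fun _ => 1
  simp only [e]
  rw [mean_mul, natCast_mul_one_div P.i, aliveProb, failProb, ← mean_mul, ← mean_mul, ← mean_add]
  refine mean_mono fun h _ => ?_
  have ha := alive_nonneg (P := P) h
  have hk : (0 : ℝ) < k + 1 := by positivity
  rw [hB.card_act]
  unfold failing
  rcases hS.succ t with h1 | h1
  · rw [h1]; simp
  · rw [h1]
    have e1 : (1 : ℝ) - k / (k + 1) = 1 / (k + 1) := by field_simp; ring
    have e2 : (k : ℝ) / (k + 1) = 1 - 1 / (k + 1) := by rw [← e1]; ring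
    by_cases hs : k ≤ (P.solvent h).card
    · simp only [hs, lt_add_iff_pos_right, zero_lt_one, and_self, if_true]
      push_cast
      rw [add_sub_cancel_left, one_mul, e1]
      linarith
    · simp only [hs, and_false, if_false]
      push_cast
      rw [add_sub_cancel_left, one_mul, e1, e2]
      simp only [zero_add, div_one, mul_one]
      linarith

/-- The payments of `i` are at most her initial budget, up to one payment. -/
theorem spent_le {K : ℝ} (hK1 : P.p 1 ≤ K) (hKk : P.p (k + 1) ≤ K) (hK : 0 ≤ K)
    (hB : P.Blocking k S) {t : ℕ} {h : Fin t → Round n} (hr : P.Reachable t h) :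
    P.T / n - P.rest h P.i ≤ P.T / n + K := by
  induction t with
  | zero => rw [rest_zero]; have : (0 : ℝ) ≤ P.T / n := by positivity
            linarith
  | succ t ih =>
    have h1 := ih hr.1
    rw [rest_succ]
    have hi := (hB.admissible t (Fin.init h)).1
    rcases hr.2 with h2 | ⟨j, hj, h2⟩ | ⟨h0, j, hj, h2⟩
    · rw [h2]; simpa [payment] using h1
    · have : j ≠ P.i := fun e => hi (e ▸ hj)
      rw [h2]; simpa [payment, this] using h1
    · have : payment P.p (h (Fin.last t)) P.i ≤ K := by
        rw [h2, payment]
        split_ifs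
        · simp only [Finset.card_insert_of_notMem hi, hB.card_act]
          split_ifs
          · exact hKk
          · simpa using hK1
        · exact hK
      linarith

/-- The expected payments of `i`, bounded through the survival and failure probabilities. -/
theorem sum_cost_le {K : ℝ} (hp : ∀ k, 0 ≤ P.p k) (hK1 : P.p 1 ≤ K) (hKk : P.p (k + 1) ≤ K)
    (hB : P.Blocking k S) (hS : IsSchedule S) (T : ℕ) :
    ∑ t ∈ Finset.range T, ((((S (t + 1) : ℝ) - S t) * (P.p (k + 1) / (k + 1)) +
        (1 - ((S (t + 1) : ℝ) - S t)) * P.p 1) * P.aliveProb t -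
        ((S (t + 1) : ℝ) - S t) * (P.p (k + 1) / (k + 1)) * P.failProb k t) ≤ P.T + n * K := by
  have hn : (n : ℝ) ≠ 0 := by exact_mod_cast (Fin.pos P.i).ne'
  have hspent : ∀ (t : ℕ) (h : Fin t → Round n),
      total (fun _ _ r => payment P.p r P.i) t h = P.T / n - P.rest h P.i := by
    intro t
    induction t with
    | zero => intro h; rw [rest_zero]; simp [total]
    | succ t ih => intro h; rw [total, ih, rest_succ]; ring
  have h1 : P.mean T (total (fun _ _ r => payment P.p r P.i) T) ≤ P.T / n + K := by
    refine mean_le_of_le fun h hr => ?_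
    rw [hspent]
    exact spent_le hK1 hKk ((hp 1).trans hK1) hB hr
  have h2 : (n : ℝ) * (P.T / n + K) = P.T + n * K := by field_simp
  rw [← h2]
  refine le_trans ?_ (mul_le_mul_of_nonneg_left h1 (Nat.cast_nonneg n))
  rw [mean_total, Finset.mul_sum]
  refine Finset.sum_le_sum fun t _ => ?_
  have e : ∀ h : Fin t → Round n, P.stepMean (1 / n) h (fun r => payment P.p r P.i) =
      1 / n * (P.alive h * (P.p ((P.act t h).card + 1) / ((P.act t h).card + 1))) := fun h =>
    stepMean_own hB.admissible _ h P.p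
  simp only [e]
  rw [mean_mul, natCast_mul_one_div P.i, aliveProb, failProb, sub_eq_add_neg, ← neg_mul, ← mean_mul,
    ← mean_mul, ← mean_add]
  refine mean_mono fun h _ => ?_
  have ha := alive_nonneg (P := P) h
  rw [hB.card_act]
  unfold failing
  rcases hS.succ t with h3 | h3
  · rw [h3]; simp [mul_comm]
  · rw [h3]
    by_cases hs : k ≤ (P.solvent h).card
    · simp only [hs, lt_add_iff_pos_right, zero_lt_one, and_self, if_true]
      push_cast
      rw [add_sub_cancel_left]
      linarith
    · simp only [hs, and_false, if_false]
      push_cast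
      rw [add_sub_cancel_left]
      -- After the opponents have failed, `i` bids alone in a scheduled round and pays p_1; this
      -- payment is simply dropped.
      have := mul_nonneg ha (hp 1)
      simp only [zero_add, div_one]
      linarith

/-! ### Collisions -/

/-- The number of rounds in which `i` bids and an opponent wins. -/
noncomputable def lost (P : Plan n) : (t : ℕ) → (Fin t → Round n) → ℝ :=
  total fun _ _ r => if P.i ∈ r.1 ∧ r.2 ≠ some P.i then 1 else 0

/-- The number of rounds that `i` wins against at least one other bidder. -/
noncomputable def contestedWins (P : Plan n) : (t : ℕ) → (Fin t → Round n) → ℝ :=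
  total fun _ _ r => if r.2 = some P.i then (if 1 < r.1.card then 1 else 0) else 0

/-- When `i` meets k opponents, she wins with probability 1/(k+1) and loses with probability
k/(k+1). -/
theorem mean_lost (hB : P.Blocking k S) (t : ℕ) :
    P.mean t (P.lost t) = k * P.mean t (P.contestedWins t) := by
  rw [lost, contestedWins, mean_total, mean_total, Finset.mul_sum]
  refine Finset.sum_congr rfl fun s _ => ?_
  rw [← mean_mul]
  congr 1
  funext h
  rw [stepMean_lost hB.admissible, stepMean_own hB.admissible _ h fun c => if 1 < c then 1 else 0,
    hB.card_act]
  split_ifs with h1 h2 h2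
  · ring
  · have : k = 0 := by omega
    subst this; simp
  · omega
  · simp

/-- Each contested win costs `i` at least c, whence the first bound. The second follows from it
because `i` still had a positive budget before her last win; the overshoot is counted as c and not
as the possibly huge actual price. -/
theorem contestedWins_mul_le {c : ℝ} (hc : 0 ≤ c) (hck : c ≤ P.p (k + 1)) (hp : ∀ k, 0 ≤ P.p k)
    (hB : P.Blocking k S) {t : ℕ} {h : Fin t → Round n} (hr : P.Reachable t h) :
    c * P.contestedWins t h ≤ P.T / n - P.rest h P.i ∧
      c * P.contestedWins t h ≤ P.T / n + c := by
  have hm : (0 : ℝ) ≤ P.T / n := by positivity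
  induction t with
  | zero => rw [rest_zero]; simp only [contestedWins, total]; constructor <;> linarith
  | succ t ih =>
    obtain ⟨h1, h2⟩ := ih hr.1
    rw [rest_succ]
    have e : P.contestedWins (t + 1) h = P.contestedWins t (Fin.init h) +
      if (h (Fin.last t)).2 = some P.i then (if 1 < (h (Fin.last t)).1.card then 1 else 0) else 0 :=
      rfl
    rw [e]
    have hi := (hB.admissible t (Fin.init h)).1
    rcases hr.2 with h3 | ⟨j, hj, h3⟩ | ⟨h0, j, hj, h3⟩
    · rw [h3]; simp [payment, h1, h2]
    · have : j ≠ P.i := fun e => hi (e ▸ hj)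
      rw [h3]; simp [payment, this, h1, h2]
    · rw [h3, payment]
      simp only [Finset.card_insert_of_notMem hi, hB.card_act]
      have := hp (0 + 1)
      split_ifs
      all_goals first | omega | constructor <;> linarith

/-- The cost of a lost collision to an opponent, counted up to her initial budget. -/
noncomputable def collisionCost (P : Plan n) (k : ℕ) : ℝ := min (P.p (k + 1)) (P.T / n)

theorem collisionCost_nonneg (hp : ∀ k, 0 ≤ P.p k) : 0 ≤ P.collisionCost k :=
  le_min (hp _) (by positivity)

/-- The budget of `i` pays for the collisions she wins, and by symmetry the opponents win k times as
many. The cap in `collisionCost` makes the overshoot at most another T/n. Compared to the opponents'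
joint budget of about T this vanishes as n grows. -/
theorem mean_collisionCost_le (hp : ∀ k, 0 ≤ P.p k) (hB : P.Blocking k S) (t : ℕ) :
    P.mean t (fun h => P.collisionCost k * P.lost t h) ≤ 2 * k * (P.T / n) := by
  rw [mean_mul, mean_lost hB]
  have h1 : P.mean t (fun h => P.collisionCost k * P.contestedWins t h) ≤ P.T / n + P.T / n :=
    mean_le_of_le fun h hr =>
      (contestedWins_mul_le (collisionCost_nonneg hp) (min_le_left _ _) hp hB hr).2.trans
        (add_le_add le_rfl (min_le_right _ _))
  rw [mean_mul] at h1
  have hk : (0 : ℝ) ≤ k := Nat.cast_nonneg k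
  calc _ = (k : ℝ) * (P.collisionCost k * P.mean t (P.contestedWins t)) := by ring
    _ ≤ k * (P.T / n + P.T / n) := mul_le_mul_of_nonneg_left h1 hk
    _ = _ := by ring

theorem lost_nonneg (t : ℕ) (h : Fin t → Round n) : 0 ≤ P.lost t h := by
  induction t with
  | zero => exact le_rfl
  | succ t ih =>
    have : P.lost (t + 1) h = P.lost t (Fin.init h) +
      if P.i ∈ (h (Fin.last t)).1 ∧ (h (Fin.last t)).2 ≠ some P.i then 1 else 0 := rfl
    rw [this]
    have := ih (Fin.init h)
    split_ifs <;> linarith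

/-! ### The opponents' spending -/

/-- The number of rounds before which at least `k` opponents were solvent. -/
noncomputable def activeRounds (P : Plan n) (k : ℕ) : (t : ℕ) → (Fin t → Round n) → ℕ
  | 0, _ => 0
  | t + 1, h => P.activeRounds k t (Fin.init h) + if k ≤ (P.solvent (Fin.init h)).card then 1 else 0

theorem activeRounds_le (t : ℕ) (h : Fin t → Round n) : P.activeRounds k t h ≤ t := by
  induction t with
  | zero => exact le_rfl
  | succ t ih =>
    rw [activeRounds]
    have := ih (Fin.init h)
    split_ifs <;> omega

/-- Budgets never increase, so opponents who are solvent now were solvent all along. -/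
theorem activeRounds_eq (hp : ∀ k, 0 ≤ P.p k) (t : ℕ) (h : Fin t → Round n)
    (hk : k ≤ (P.solvent h).card) : P.activeRounds k t h = t := by
  induction t with
  | zero => rfl
  | succ t ih =>
    have h1 := hk.trans (Finset.card_le_card (solvent_succ_subset hp h))
    rw [activeRounds, ih _ h1, if_pos h1]

/-- The payments of the opponents, each counted up to her initial budget. -/
noncomputable def cappedSpending (P : Plan n) {t : ℕ} (h : Fin t → Round n) : ℝ :=
  ∑ j ∈ Finset.univ.erase P.i, min (P.T / n : ℝ) (P.T / n - P.rest h j)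

theorem cappedSpending_succ_of_eq {t : ℕ} {h : Fin (t + 1) → Round n}
    (hw : ∀ j, j ≠ P.i → (h (Fin.last t)).2 ≠ some j) :
    P.cappedSpending h = P.cappedSpending (Fin.init h) := by
  refine Finset.sum_congr rfl fun j hj => ?_
  rw [rest_succ, payment, if_neg (hw j (Finset.ne_of_mem_erase hj)), sub_zero]

theorem cappedSpending_succ_le (hp : ∀ k, 0 ≤ P.p k) {t : ℕ} {h : Fin (t + 1) → Round n} {j : Fin n}
    (hj : j ≠ P.i) (hw : (h (Fin.last t)).2 = some j) :
    P.cappedSpending h ≤ P.cappedSpending (Fin.init h) +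
      min (P.p (h (Fin.last t)).1.card) (P.T / n) := by
  have hj' : j ∈ Finset.univ.erase P.i := Finset.mem_erase.2 ⟨hj, Finset.mem_univ j⟩
  rw [cappedSpending, cappedSpending, ← Finset.add_sum_erase _ _ hj', ← Finset.add_sum_erase _ _ hj']
  have h1 : ∑ a ∈ (Finset.univ.erase P.i).erase j, min (P.T / n : ℝ) (P.T / n - P.rest h a) =
      ∑ a ∈ (Finset.univ.erase P.i).erase j, min (P.T / n : ℝ) (P.T / n - P.rest (Fin.init h) a) := by
    refine Finset.sum_congr rfl fun a ha => ?_
    have : j ≠ a := (Finset.ne_of_mem_erase ha).symm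
    rw [rest_succ, payment, hw, if_neg (by simpa using this), sub_zero]
  rw [h1, rest_succ, payment, if_pos hw]
  have h2 := rest_le hp (Fin.init h) j
  have h3 := hp (h (Fin.last t)).1.card
  have h4 : (0 : ℝ) ≤ P.T / n := by positivity
  have : min (P.T / n : ℝ) (P.T / n - (P.rest (Fin.init h) j - P.p (h (Fin.last t)).1.card)) ≤
      min (P.T / n : ℝ) (P.T / n - P.rest (Fin.init h) j) + min (P.p (h (Fin.last t)).1.card) (P.T / n) := by
    rcases min_cases (P.T / n : ℝ) (P.T / n - P.rest (Fin.init h) j) with ⟨e, _⟩ | ⟨e, _⟩ <;>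
    rcases min_cases (P.p (h (Fin.last t)).1.card) (P.T / n : ℝ) with ⟨e', _⟩ | ⟨e', _⟩ <;>
    rw [e, e']
    · exact (min_le_left _ _).trans (by linarith)
    · exact (min_le_left _ _).trans (by linarith)
    · exact (min_le_right _ _).trans (by linarith)
    · exact (min_le_left _ _).trans (by linarith)
  linarith

/-- A win of an opponent while `i` does not bid costs p_k and uses up a scheduled round; a win
against `i` costs at most `collisionCost` after capping. `activeRounds` freezes the count of
scheduled rounds once the opponents have failed. -/
theorem cappedSpending_le (hp : ∀ k, 0 ≤ P.p k) (hB : P.Blocking k S) (hS : IsSchedule S) {t : ℕ}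
    {h : Fin t → Round n} (hr : P.Reachable t h) :
    P.cappedSpending h ≤ P.p k * S (P.activeRounds k t h) + P.collisionCost k * P.lost t h := by
  induction t with
  | zero =>
    have : P.cappedSpending h = 0 := by
      have : (0 : ℝ) ≤ P.T / n := by positivity
      simp [cappedSpending, rest_zero, this]
    rw [this]
    simp [activeRounds, hS.zero, lost, total]
  | succ t ih =>
    have h1 := ih hr.1
    have hi := (hB.admissible t (Fin.init h)).1
    have hc := hB.card_act t (Fin.init h)
    have hcc := collisionCost_nonneg (P := P) (k := k) hp
    have el : P.lost (t + 1) h = P.lost t (Fin.init h) +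
      if P.i ∈ (h (Fin.last t)).1 ∧ (h (Fin.last t)).2 ≠ some P.i then 1 else 0 := rfl
    have hmono : P.p k * (S (P.activeRounds k t (Fin.init h)) : ℝ) ≤
        P.p k * S (P.activeRounds k (t + 1) h) := by
      refine mul_le_mul_of_nonneg_left ?_ (hp k)
      exact_mod_cast hS.monotone (Nat.le_add_right _ _)
    have hlost : P.collisionCost k * P.lost t (Fin.init h) ≤ P.collisionCost k * P.lost (t + 1) h := by
      refine mul_le_mul_of_nonneg_left ?_ hcc
      rw [el]; split_ifs <;> linarith
    have quiet : (∀ j, j ≠ P.i → (h (Fin.last t)).2 ≠ some j) → P.cappedSpending h ≤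
        P.p k * S (P.activeRounds k (t + 1) h) + P.collisionCost k * P.lost (t + 1) h := fun hw => by
      rw [cappedSpending_succ_of_eq hw]; linarith
    rcases hr.2 with h3 | ⟨j, hj, h3⟩ | ⟨h0, j, hj, h3⟩
    · exact quiet fun j _ => by rw [h3]; simp
    · have hji : j ≠ P.i := fun e => hi (e ▸ hj)
      have h4 := cappedSpending_succ_le (h := h) hp hji (by rw [h3])
      have hpos : 0 < (P.act t (Fin.init h)).card := Finset.card_pos.2 ⟨j, hj⟩
      rw [h3] at h4
      simp only at h4
      split_ifs at hc with hcond
      · rw [hc] at h4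
        have e1 : P.activeRounds k (t + 1) h = t + 1 := by
          rw [activeRounds, activeRounds_eq hp _ _ hcond.2, if_pos hcond.2]
        have e2 : S (t + 1) = S t + 1 := by rcases hS.succ t with h | h <;> omega
        rw [activeRounds_eq hp _ _ hcond.2] at h1
        rw [e1, e2]
        push_cast
        have := min_le_left (P.p k) (P.T / n : ℝ)
        linarith
      · omega
    · by_cases hji : j = P.i
      · exact quiet fun a ha => by rw [h3, hji]; simpa using ha.symm
      · have h4 := cappedSpending_succ_le (h := h) hp hji (by rw [h3])
        have hj' : j ∈ P.act t (Fin.init h) := (Finset.mem_insert.1 hj).resolve_left hji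
        have hpos : 0 < (P.act t (Fin.init h)).card := Finset.card_pos.2 ⟨j, hj'⟩
        rw [h3] at h4
        simp only [Finset.card_insert_of_notMem hi] at h4
        split_ifs at hc with hcond
        · rw [hc] at h4
          rw [el, h3, if_pos ⟨Finset.mem_insert_self _ _, by simpa using hji⟩]
          change _ ≤ _ + P.collisionCost k at h4
          linarith
        · omega

/-- Of the n - 1 opponents at most k - 1 are solvent, and each of the remaining n - k or more
contributes the full cap T/n. -/
theorem le_cappedSpending (hp : ∀ k, 0 ≤ P.p k) {t : ℕ} {h : Fin t → Round n}
    (hf : (P.solvent h).card < k) : ((n : ℝ) - k) * (P.T / n) ≤ P.cappedSpending h := by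
  have hm : (0 : ℝ) ≤ P.T / n := by positivity
  have hsub : P.solvent h ⊆ Finset.univ.erase P.i := fun j hj =>
    Finset.mem_erase.2 ⟨(mem_solvent.1 hj).1, Finset.mem_univ j⟩
  have h1 : ∑ j ∈ Finset.univ.erase P.i \ P.solvent h, (P.T / n : ℝ) ≤ P.cappedSpending h := by
    refine (Finset.sum_le_sum fun j hj => ?_).trans (Finset.sum_le_sum_of_subset_of_nonneg
      Finset.sdiff_subset fun j _ _ => le_min hm (sub_nonneg.2 (rest_le hp h j)))
    rw [Finset.mem_sdiff, mem_solvent] at hj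
    have : P.rest h j ≤ 0 := not_lt.1 fun h' => hj.2 ⟨Finset.ne_of_mem_erase hj.1, h'⟩
    exact le_min le_rfl (by linarith)
  refine le_trans ?_ h1
  rw [Finset.sum_const, nsmul_eq_mul]
  refine mul_le_mul_of_nonneg_right ?_ hm
  rw [Finset.card_sdiff_of_subset hsub, Finset.card_erase_of_mem (Finset.mem_univ _), Finset.card_univ,
    Fintype.card_fin]
  have := Fin.pos P.i
  have h2 : n ≤ (n - 1 - (P.solvent h).card) + k := by omega
  have h3 : (n : ℝ) ≤ ((n - 1 - (P.solvent h).card : ℕ) : ℝ) + k := by exact_mod_cast h2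
  linarith

/-- A lower bound on the cost of collisions when the opponents fail. -/
theorem fail_cost (hp : ∀ k, 0 ≤ P.p k) (hB : P.Blocking k S) (hS : IsSchedule S) {t : ℕ}
    {h : Fin t → Round n} (hr : P.Reachable t h) (hf : (P.solvent h).card < k) :
    ((n : ℝ) - k) * (P.T / n) ≤
      P.p k * S (P.activeRounds k t h) + P.collisionCost k * P.lost t h :=
  (le_cappedSpending hp hf).trans (cappedSpending_le hp hB hS hr)

/-- Failure is improbable as long as the regular payments stay below the budgets. -/
theorem failProb_mul_le (hp : ∀ k, 0 ≤ P.p k) (hB : P.Blocking k S) (hS : IsSchedule S) (t : ℕ) :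
    P.failProb k t * (((n : ℝ) - k) * (P.T / n) - P.p k * S t) ≤ 2 * k * (P.T / n) := by
  refine le_trans ?_ (mean_collisionCost_le hp hB t)
  rw [mul_comm, failProb, ← mean_mul]
  refine mean_mono fun h hr => ?_
  have h0 : 0 ≤ P.collisionCost k * P.lost t h :=
    mul_nonneg (collisionCost_nonneg hp) (lost_nonneg t h)
  unfold failing alive
  split_ifs with h1 h2 h2
  · simpa using h0
  · have h3 := fail_cost hp hB hS hr (not_le.1 h2)
    have h4 : P.p k * (S (P.activeRounds k t h) : ℝ) ≤ P.p k * S t := by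
      refine mul_le_mul_of_nonneg_left ?_ (hp k)
      exact_mod_cast hS.monotone (activeRounds_le t h)
    linarith
  · simpa using h0
  · simpa using h0

end Plan

namespace Plan

variable {n : ℕ} {P : Plan n} {k : ℕ} {S : ℕ → ℕ}

/-! ### Fluctuations of the payments of `i` -/

/-- `n` times the expected payment of `i` in round `t` while nobody fails. -/
noncomputable def drift (P : Plan n) (k : ℕ) (S : ℕ → ℕ) (t : ℕ) : ℝ :=
  ((S (t + 1) : ℝ) - S t) * (P.p (k + 1) / (k + 1)) + (1 - ((S (t + 1) : ℝ) - S t)) * P.p 1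

/-- The deviation of `n` times the payments of `i` from their drift while nobody fails. -/
noncomputable def fluctuation (P : Plan n) (k : ℕ) (S : ℕ → ℕ) : (t : ℕ) → (Fin t → Round n) → ℝ :=
  total fun t h r => if 0 < P.rest h P.i ∧ k ≤ (P.solvent h).card then
    n * payment P.p r P.i - P.drift k S t else 0

/-- The increments are martingale differences. A payment of at most K occurs with probability at
most 1/n, so after scaling by n its second moment is at most n² · K²/n. -/
theorem stepMean_fluctuation (hp : ∀ k, 0 ≤ P.p k) {K : ℝ} (hK1 : P.p 1 ≤ K) (hKk : P.p (k + 1) ≤ K)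
    (hB : P.Blocking k S) (hS : IsSchedule S) {t : ℕ} (h : Fin t → Round n)
    (hc : 0 < P.rest h P.i ∧ k ≤ (P.solvent h).card) :
    P.stepMean (1 / n) h (fun r => n * payment P.p r P.i - P.drift k S t) = 0 ∧
    P.stepMean (1 / n) h (fun r => (n * payment P.p r P.i - P.drift k S t) ^ 2) ≤ n * K ^ 2 := by
  have hn : (n : ℝ) ≠ 0 := by exact_mod_cast (Fin.pos P.i).ne'
  have ha : P.alive h = 1 := if_pos hc.1
  have hd : P.p ((P.act t h).card + 1) / (((P.act t h).card : ℝ) + 1) = P.drift k S t := by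
    rw [hB.card_act, drift]
    rcases hS.succ t with h1 | h1
    · simp [h1]
    · simp [h1, hc.2]
  have hle : P.p ((P.act t h).card + 1) ≤ K := by
    rw [hB.card_act]
    split_ifs
    · exact hKk
    · simpa using hK1
  have e1 : P.stepMean (1 / n) h (fun r => payment P.p r P.i) = 1 / n * P.drift k S t := by
    have := stepMean_own hB.admissible (1 / (n : ℝ)) h P.p
    rw [ha, one_mul, hd] at this
    exact this
  have e2 : P.stepMean (1 / n) h (fun r => payment P.p r P.i ^ 2) ≤ 1 / n * K ^ 2 := by
    have h2 := stepMean_own hB.admissible (1 / (n : ℝ)) h fun c => P.p c ^ 2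
    rw [ha, one_mul] at h2
    have e : (fun r : Round n => payment P.p r P.i ^ 2) =
        fun r => if r.2 = some P.i then P.p r.1.card ^ 2 else 0 := by
      funext r; unfold payment; split_ifs <;> simp
    rw [e, h2]
    refine mul_le_mul_of_nonneg_left ?_ (by positivity)
    refine (div_le_self (sq_nonneg _) (by linarith [(Nat.cast_nonneg (P.act t h).card : (0 : ℝ) ≤ _)])).trans ?_
    exact pow_le_pow_left₀ (hp _) hle 2
  constructor
  · simp only [sub_eq_add_neg]
    rw [stepMean_add, stepMean_mul, stepMean_const, e1]
    field_simp; ring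
  · have e3 : (fun r : Round n => (n * payment P.p r P.i - P.drift k S t) ^ 2) = fun r =>
        (n : ℝ) ^ 2 * payment P.p r P.i ^ 2 +
          (-(2 * n * P.drift k S t) * payment P.p r P.i + P.drift k S t ^ 2) := by
      funext r; ring
    rw [e3, stepMean_add, stepMean_add, stepMean_mul, stepMean_mul, stepMean_const, e1]
    have e4 : -(2 * (n : ℝ) * P.drift k S t) * (1 / n * P.drift k S t) = -(2 * P.drift k S t ^ 2) := by
      field_simp
    have e5 : (n : ℝ) ^ 2 * P.stepMean (1 / n) h (fun r => payment P.p r P.i ^ 2) ≤ n * K ^ 2 := by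
      calc _ ≤ (n : ℝ) ^ 2 * (1 / n * K ^ 2) := mul_le_mul_of_nonneg_left e2 (sq_nonneg _)
        _ = n * K ^ 2 := by field_simp
    rw [e4]
    nlinarith [sq_nonneg (P.drift k S t)]

/-- Martingale increments are orthogonal, so the second moments add up. -/
theorem mean_fluctuation_sq_le (hp : ∀ k, 0 ≤ P.p k) {K : ℝ} (hK1 : P.p 1 ≤ K)
    (hKk : P.p (k + 1) ≤ K) (hB : P.Blocking k S) (hS : IsSchedule S) (t : ℕ) :
    P.mean t (fun h => P.fluctuation k S t h ^ 2) ≤ t * (n * K ^ 2) := by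
  induction t with
  | zero => simp [mean, fluctuation, total]
  | succ t ih =>
    rw [mean]
    have h1 : P.mean t (fun h => P.stepMean (1 / n) h fun r =>
        P.fluctuation k S (t + 1) (Fin.snoc (α := fun _ => Round n) h r) ^ 2) ≤
        P.mean t fun h => P.fluctuation k S t h ^ 2 + n * K ^ 2 := by
      refine mean_mono fun h _ => ?_
      have hK : 0 ≤ (n : ℝ) * K ^ 2 := by positivity
      simp only [fluctuation, total_snoc]
      by_cases hc : 0 < P.rest h P.i ∧ k ≤ (P.solvent h).card
      · simp only [if_pos hc, add_sq]
        obtain ⟨h2, h3⟩ := stepMean_fluctuation hp hK1 hKk hB hS h hc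
        rw [stepMean_add, stepMean_add, stepMean_const, stepMean_mul, h2]
        linarith
      · simp only [if_neg hc, add_zero, stepMean_const]
        linarith
    rw [mean_add, mean_const] at h1
    push_cast
    linarith

/-- Fluctuation plus accumulated drift is n times what `i` has paid in the active rounds. Only an
inequality holds, since payments after the failure of the opponents are not counted on the left. -/
theorem fluctuation_add_le (hp : ∀ k, 0 ≤ P.p k) (hS : IsSchedule S) {t : ℕ}
    (h : Fin t → Round n) (ha : 0 < P.rest h P.i) :
    P.fluctuation k S t h + (P.p (k + 1) / (k + 1) * S (P.activeRounds k t h) +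
        P.p 1 * ((P.activeRounds k t h : ℝ) - S (P.activeRounds k t h))) ≤
      n * (P.T / n - P.rest h P.i) := by
  induction t with
  | zero => rw [rest_zero]; simp [fluctuation, total, activeRounds, hS.zero]
  | succ t ih =>
    have hpay := payment_nonneg hp (h (Fin.last t)) P.i
    have e := rest_succ (P := P) h P.i
    have ha' : 0 < P.rest (Fin.init h) P.i := by linarith
    have h1 := ih (Fin.init h) ha'
    have ef : P.fluctuation k S (t + 1) h = P.fluctuation k S t (Fin.init h) +
      if 0 < P.rest (Fin.init h) P.i ∧ k ≤ (P.solvent (Fin.init h)).card then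
        n * payment P.p (h (Fin.last t)) P.i - P.drift k S t else 0 := rfl
    rw [ef, e]
    by_cases hk : k ≤ (P.solvent (Fin.init h)).card
    · rw [if_pos ⟨ha', hk⟩, activeRounds, if_pos hk]
      rw [activeRounds_eq hp _ _ hk] at h1 ⊢
      rw [drift]
      push_cast
      linarith
    · rw [if_neg fun hc => hk hc.2, activeRounds, if_neg hk]
      have : 0 ≤ (n : ℝ) * payment P.p (h (Fin.last t)) P.i := by positivity
      simp only [add_zero]
      linarith

/-! ### The opponents rarely fail -/

/-- Markov's inequality for the collision costs: the regular payments leave a reserve εT, of which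
the correction k/n takes at most half, and failure requires that collisions consume the rest. -/
theorem failProb_le_of_spending {ε : ℝ} (hε : 0 < ε) (hp : ∀ k, 0 ≤ P.p k) (hB : P.Blocking k S)
    (hS : IsSchedule S) (hT : 0 < P.T) (hkn : k ≤ ε / 2 * n) {t : ℕ}
    (ht : P.p k * S t ≤ (1 - ε) * P.T) : P.failProb k t ≤ 4 * k / (ε * n) := by
  have hn : (0 : ℝ) < n := by exact_mod_cast Fin.pos P.i
  have hT' : (0 : ℝ) < P.T := by exact_mod_cast hT
  have h1 := failProb_mul_le hp hB hS t
  have h2 : ε * P.T / 2 ≤ ((n : ℝ) - k) * (P.T / n) - P.p k * S t := by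
    have e : ((n : ℝ) - k) * (P.T / n) = P.T - k * (P.T / n) := by field_simp
    have h3 : (k : ℝ) * (P.T / n) ≤ ε / 2 * n * (P.T / n) :=
      mul_le_mul_of_nonneg_right hkn (by positivity)
    have e2 : ε / 2 * n * (P.T / n) = ε * P.T / 2 := by field_simp
    linarith
  have h3 := (mul_le_mul_of_nonneg_left h2 (failProb_nonneg (P := P) k t)).trans h1
  rw [le_div_iff₀ (by positivity)]
  have e3 : 2 * (k : ℝ) * (P.T / n) * (2 * n / P.T) = 4 * k := by field_simp; ring
  have e4 : P.failProb k t * (ε * P.T / 2) * (2 * n / P.T) = P.failProb k t * (ε * n) := by field_simp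
  rw [← e3, ← e4]
  exact mul_le_mul_of_nonneg_right h3 (by positivity)

/-- `S` counts a set of rounds that has density `γ` in every initial segment, up to one round. -/
structure HasDensity (S : ℕ → ℕ) (γ : ℝ) : Prop extends IsSchedule S where
  le : ∀ t, (S t : ℝ) ≤ γ * t
  ge : ∀ t, γ * t - 1 ≤ S t

theorem hasDensity_floor {γ : ℝ} (h0 : 0 ≤ γ) (h1 : γ ≤ 1) : HasDensity (fun t => ⌊γ * t⌋₊) γ where
  zero := by simp
  succ t := by
    have h2 : ⌊γ * t⌋₊ ≤ ⌊γ * (t + 1 : ℕ)⌋₊ := by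
      refine Nat.floor_mono (mul_le_mul_of_nonneg_left ?_ h0)
      exact_mod_cast Nat.le_succ t
    have h3 : ⌊γ * (t + 1 : ℕ)⌋₊ ≤ ⌊γ * t⌋₊ + 1 := by
      rw [← Nat.floor_add_one (by positivity)]
      refine Nat.floor_mono ?_
      push_cast; linarith
    omega
  le t := Nat.floor_le (by positivity)
  ge t := by linarith [Nat.lt_floor_add_one (γ * (t : ℝ))]

/-- Here s is the number of active rounds, c the scheduled ones among them, V the collision cost and
G the fluctuation. By `h1` the opponents have spent nearly T, which forces s to be almost T/K. Over
s rounds the rate advantage ε amounts to nearly 16ηT, while the error terms sum to at most 3ηT. As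
`h2` says that `i` has not overspent, G must be very negative. -/
theorem race_deviation_le {ε K γ η q p₁ pₖ s c T V G : ℝ} (hε1 : ε ≤ 1) (hK : 1 ≤ K)
    (hη0 : 0 < η) (hη : η * (16 * K) = ε) (hγ1 : γ ≤ 1) (hqK : q ≤ K)
    (hp₁ : 0 ≤ p₁) (hpₖ : 0 ≤ pₖ) (hpₖK : pₖ ≤ K) (hT : 0 ≤ T) (hs : 0 ≤ s)
    (hc : c ≤ γ * s) (hc' : γ * s - 1 ≤ c) (hγ : γ * pₖ ≤ γ * q + (1 - γ) * p₁ - ε)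
    (hKT : K ≤ η * T) (hV : V ≤ η * T) (h1 : T - η * T ≤ pₖ * c + V)
    (h2 : G + (q * c + p₁ * (s - c)) ≤ T) : G ≤ -(η * T) := by
  have h7 : pₖ * c ≤ γ * pₖ * s := by
    have := mul_le_mul_of_nonneg_left hc hpₖ
    linarith
  have h8 : γ * pₖ ≤ K := (mul_le_of_le_one_left hpₖ hγ1).trans hpₖK
  have h9 : γ * pₖ * s ≤ K * s := mul_le_mul_of_nonneg_right h8 hs
  have h10 : γ * pₖ * s ≤ (γ * q + (1 - γ) * p₁ - ε) * s := mul_le_mul_of_nonneg_right hγ hs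
  have h11 : (γ * q + (1 - γ) * p₁) * s - K ≤ q * c + p₁ * (s - c) := by
    have h13 : q - p₁ ≤ K := by linarith
    have h14 : 0 ≤ γ * s - c := by linarith
    have h15 : K * (γ * s - c) ≤ K * 1 := mul_le_mul_of_nonneg_left (by linarith) (by linarith)
    have h16 := mul_le_mul_of_nonneg_right h13 h14
    linarith
  have h16 : T - 2 * (η * T) ≤ K * s := by linarith
  have h17 : 16 * η * (T - 2 * (η * T)) ≤ ε * s := by
    have := mul_le_mul_of_nonneg_left h16 (show 0 ≤ 16 * η by positivity)
    rw [← hη]; linarith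
  have hη2 : η ≤ 1 / 16 := by
    have := mul_le_mul_of_nonneg_left hK hη0.le
    linarith
  have h18 : η * (η * T) ≤ 1 / 16 * (η * T) := mul_le_mul_of_nonneg_right hη2 (by positivity)
  linarith

/-- If `i` pays faster than the opponents do, then she probably runs out of budget before them. -/
theorem failProb_le_of_race {ε K γ η : ℝ} (hε : 0 < ε) (hε1 : ε ≤ 1) (hK : 1 ≤ K)
    (hη : η = ε / (16 * K)) (hγ1 : γ ≤ 1) (hp : ∀ k, 0 ≤ P.p k)
    (hK1 : P.p 1 ≤ K) (hKk : P.p k ≤ K) (hKk' : P.p (k + 1) ≤ K)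
    (hB : P.Blocking k S) (hS : HasDensity S γ)
    (hγ : γ * P.p k ≤ γ * (P.p (k + 1) / (k + 1)) + (1 - γ) * P.p 1 - ε)
    (hkn : k ≤ η * n) (hKT : K ≤ η * P.T) {t : ℕ} (ht : t ≤ P.T) :
    P.failProb k t ≤ 2 * k / (η * n) + n * K ^ 2 / (η ^ 2 * P.T) := by
  have hn : (0 : ℝ) < n := by exact_mod_cast Fin.pos P.i
  have hK0 : 0 < K := by linarith
  have hη0 : 0 < η := by rw [hη]; positivity
  have hT : (0 : ℝ) < P.T := pos_of_mul_pos_right (hK0.trans_le hKT) hη0.le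
  have hηT : 0 < η * P.T := by positivity
  -- Failure while `i` is alive forces a large collision cost or a large fluctuation. The two
  -- summands are the corresponding Markov and Chebyshev bounds, applied pointwise.
  have key : P.failProb k t ≤ P.mean t fun h => 1 / (η * P.T) * (P.collisionCost k * P.lost t h) +
      1 / (η * P.T) ^ 2 * P.fluctuation k S t h ^ 2 := by
    refine mean_mono fun h hr => ?_
    have hV : 0 ≤ P.collisionCost k * P.lost t h :=
      mul_nonneg (collisionCost_nonneg hp) (lost_nonneg t h)
    have h0 : 0 ≤ 1 / (η * P.T) * (P.collisionCost k * P.lost t h) := by positivity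
    have h0' : 0 ≤ 1 / (η * P.T) ^ 2 * P.fluctuation k S t h ^ 2 := by positivity
    by_cases hc : 0 < P.rest h P.i ∧ ¬ k ≤ (P.solvent h).card
    · have e1 : P.alive h * P.failing k h = 1 := by simp [alive, failing, hc.1, hc.2]
      rw [e1]
      have h1 := fail_cost hp hB hS.toIsSchedule hr (not_le.1 hc.2)
      have h2 := fluctuation_add_le (k := k) hp hS.toIsSchedule h hc.1
      generalize P.collisionCost k * P.lost t h = V at *
      generalize P.fluctuation k S t h = G at *
      generalize P.activeRounds k t h = r at *
      by_cases hVT : η * P.T < V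
      · have : 1 ≤ 1 / (η * P.T) * V := by
          rw [one_div_mul_eq_div, one_le_div hηT]; exact hVT.le
        linarith
      · have hVT := not_lt.1 hVT
        have hG : G ≤ -(η * P.T) := by
          have e2 : ((n : ℝ) - k) * (P.T / n) = P.T - k / n * P.T := by field_simp
          have e3 : (n : ℝ) * (P.T / n - P.rest h P.i) = P.T - n * P.rest h P.i := by field_simp
          have h3 : (k : ℝ) / n ≤ η := (div_le_iff₀ hn).2 hkn
          have h3' : (k : ℝ) / n * P.T ≤ η * P.T := mul_le_mul_of_nonneg_right h3 hT.le
          have h4 : 0 ≤ (n : ℝ) * P.rest h P.i := mul_nonneg hn.le hc.1.le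
          exact race_deviation_le hε1 hK hη0 (by rw [hη]; field_simp) hγ1
            ((div_le_self (hp _) (by linarith [(Nat.cast_nonneg k : (0 : ℝ) ≤ k)])).trans hKk')
            (hp 1) (hp k) hKk hT.le (Nat.cast_nonneg r) (hS.le r) (hS.ge r) hγ hKT hVT
            (by linarith) (by linarith)
        have : 1 ≤ 1 / (η * P.T) ^ 2 * G ^ 2 := by
          rw [one_div_mul_eq_div, one_le_div (by positivity)]
          nlinarith
        linarith
    · have e1 : P.alive h * P.failing k h = 0 := by
        unfold alive failing
        by_cases h1 : 0 < P.rest h P.i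
        · simp [not_not.1 fun h2 => hc ⟨h1, h2⟩]
        · simp [h1]
      rw [e1]; linarith
  refine key.trans ?_
  rw [mean_add, mean_mul t (1 / (η * P.T)) fun h => P.collisionCost k * P.lost t h,
    mean_mul t (1 / (η * P.T) ^ 2) fun h => P.fluctuation k S t h ^ 2]
  have h1 := mean_collisionCost_le hp hB t
  have h2 := mean_fluctuation_sq_le hp hK1 hKk' hB hS.toIsSchedule t
  have h3 : (t : ℝ) * (n * K ^ 2) ≤ P.T * (n * K ^ 2) :=
    mul_le_mul_of_nonneg_right (by exact_mod_cast ht) (by positivity)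
  refine add_le_add ?_ ?_
  · calc _ ≤ 1 / (η * P.T) * (2 * k * (P.T / n)) := mul_le_mul_of_nonneg_left h1 (by positivity)
      _ = _ := by field_simp
  · calc _ ≤ 1 / (η * P.T) ^ 2 * (P.T * (n * K ^ 2)) :=
        mul_le_mul_of_nonneg_left (h2.trans h3) (by positivity)
      _ = _ := by field_simp

/-! ### Upper bounds on the number of wins -/

/-- Weighting an antitone sequence by a schedule of density `γ` amounts to multiplying by `γ`. -/
theorem abs_sum_schedule_sub_le {x : ℕ → ℝ} (hx : Antitone x) (hx0 : ∀ t, 0 ≤ x t)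
    (hx1 : ∀ t, x t ≤ 1) {γ : ℝ} (hS : HasDensity S γ) (T : ℕ) :
    |∑ t ∈ Finset.range T, ((S (t + 1) : ℝ) - S t) * x t - γ * ∑ t ∈ Finset.range T, x t| ≤ 1 := by
  -- Summation by parts: the discrepancy S t - γt lies in [-1, 0], and the decrements of x sum to x
  -- 0 - x T.
  have h : x T * (S T - γ * T) - (x 0 - x T) ≤
      ∑ t ∈ Finset.range T, ((S (t + 1) : ℝ) - S t) * x t - γ * ∑ t ∈ Finset.range T, x t ∧
      ∑ t ∈ Finset.range T, ((S (t + 1) : ℝ) - S t) * x t - γ * ∑ t ∈ Finset.range T, x t ≤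
        x T * (S T - γ * T) := by
    induction T with
    | zero => simp [hS.zero]
    | succ T ih =>
      rw [Finset.sum_range_succ, Finset.sum_range_succ]
      have h1 := hS.le (T + 1)
      have h2 := hS.ge (T + 1)
      have h3 := hx (Nat.le_succ T)
      push_cast at h1 h2 ⊢
      constructor <;> nlinarith
  have h1 := hS.le T
  have h2 := hS.ge T
  have h3 := hx0 T
  have h4 := hx1 0
  rw [abs_le]
  constructor <;> nlinarith

theorem schedule_step_le_one (hS : IsSchedule S) (t : ℕ) : (S (t + 1) : ℝ) - S t ≤ 1 := by
  rcases hS.succ t with h | h <;> rw [h] <;> simp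

theorem natCast_div_succ_mem (k : ℕ) : (0 : ℝ) ≤ k / (k + 1) ∧ (k : ℝ) / (k + 1) ≤ 1 :=
  ⟨by positivity, div_le_one_of_le₀ (by linarith) (by positivity)⟩

theorem mean_wins_le_of_failProb_le {γ φ : ℝ} (hp : ∀ k, 0 ≤ P.p k) (hB : P.Blocking k S)
    (hS : HasDensity S γ) (hφ : ∀ t < P.T, P.failProb k t ≤ φ) :
    n * P.mean P.T (wins P.i P.T) ≤
      (1 - γ * (k / (k + 1))) * ∑ t ∈ Finset.range P.T, P.aliveProb t + 1 + φ * P.T := by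
  obtain ⟨hκ0, hκ1⟩ := natCast_div_succ_mem k
  refine (mean_wins_le hB hS.toIsSchedule P.T).trans ?_
  have h1 := (abs_le.1 (abs_sum_schedule_sub_le (antitone_aliveProb hp) aliveProb_nonneg
    aliveProb_le_one hS P.T)).1
  have h2 : ∑ t ∈ Finset.range P.T, ((S (t + 1) : ℝ) - S t) * (k / (k + 1)) * P.failProb k t ≤
      φ * P.T := by
    calc _ ≤ ∑ t ∈ Finset.range P.T, φ := by
          refine Finset.sum_le_sum fun t ht => ?_
          have := mul_le_one₀ (schedule_step_le_one hS.toIsSchedule t) hκ0 hκ1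
          exact (mul_le_of_le_one_left (failProb_nonneg _ _) this).trans (hφ t (Finset.mem_range.1 ht))
      _ = φ * P.T := by simp [mul_comm]
  rw [Finset.sum_add_distrib]
  have h3 : ∑ t ∈ Finset.range P.T, (1 - ((S (t + 1) : ℝ) - S t) * (k / (k + 1))) * P.aliveProb t =
      ∑ t ∈ Finset.range P.T, P.aliveProb t -
        k / (k + 1) * ∑ t ∈ Finset.range P.T, ((S (t + 1) : ℝ) - S t) * P.aliveProb t := by
    rw [Finset.mul_sum, ← Finset.sum_sub_distrib]
    exact Finset.sum_congr rfl fun t _ => by ring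
  rw [h3]
  nlinarith

theorem sum_aliveProb_le (T : ℕ) : ∑ t ∈ Finset.range T, P.aliveProb t ≤ T := by
  calc _ ≤ ∑ t ∈ Finset.range T, (1 : ℝ) := Finset.sum_le_sum fun t _ => aliveProb_le_one t
    _ = T := by simp

/-- The total survival time of `i` is bounded by her budget. -/
theorem cost_mul_sum_aliveProb_le {γ φ K : ℝ} (hp : ∀ k, 0 ≤ P.p k) (hK1 : P.p 1 ≤ K)
    (hKk : P.p (k + 1) ≤ K) (hB : P.Blocking k S) (hS : HasDensity S γ)
    (hφ : ∀ t < P.T, P.failProb k t ≤ φ) :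
    (γ * (P.p (k + 1) / (k + 1)) + (1 - γ) * P.p 1) * ∑ t ∈ Finset.range P.T, P.aliveProb t ≤
      P.T + (n + 1) * K + K * φ * P.T := by
  have h0 := sum_cost_le hp hK1 hKk hB hS.toIsSchedule P.T
  have h1 := abs_le.1 (abs_sum_schedule_sub_le (antitone_aliveProb hp) aliveProb_nonneg
    aliveProb_le_one hS P.T)
  set q := P.p (k + 1) / ((k : ℝ) + 1) with hq
  have hq0 : 0 ≤ q := div_nonneg (hp _) (by positivity)
  have hqK : q ≤ K :=
    (div_le_self (hp _) (by linarith [(Nat.cast_nonneg k : (0 : ℝ) ≤ k)])).trans hKk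
  have h2 : ∑ t ∈ Finset.range P.T, ((S (t + 1) : ℝ) - S t) * q * P.failProb k t ≤ K * φ * P.T := by
    calc _ ≤ ∑ t ∈ Finset.range P.T, K * φ := by
          refine Finset.sum_le_sum fun t ht => ?_
          have h3 : ((S (t + 1) : ℝ) - S t) * q ≤ K :=
            (mul_le_of_le_one_left hq0 (schedule_step_le_one hS.toIsSchedule t)).trans hqK
          exact mul_le_mul h3 (hφ t (Finset.mem_range.1 ht)) (failProb_nonneg _ _) (hq0.trans hqK)
      _ = K * φ * P.T := by simp [mul_comm]
  rw [Finset.sum_sub_distrib] at h0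
  have h3 : ∑ t ∈ Finset.range P.T, (((S (t + 1) : ℝ) - S t) * q +
        (1 - ((S (t + 1) : ℝ) - S t)) * P.p 1) * P.aliveProb t =
      P.p 1 * ∑ t ∈ Finset.range P.T, P.aliveProb t +
        (q - P.p 1) * ∑ t ∈ Finset.range P.T, ((S (t + 1) : ℝ) - S t) * P.aliveProb t := by
    rw [Finset.mul_sum, Finset.mul_sum, ← Finset.sum_add_distrib]
    exact Finset.sum_congr rfl fun t _ => by ring
  rw [h3] at h0
  have h12 : -K ≤ q - P.p 1 := by linarith
  have h13 : q - P.p 1 ≤ K := by linarith [hp 1]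
  nlinarith

/-- The fraction of her ideal utility that `i` obtains when a fraction `γ` of the rounds is
contested by `k` opponents who rarely fail. -/
theorem wins_fraction_le {γ φ K : ℝ} (hγ0 : 0 ≤ γ) (hγ1 : γ ≤ 1) (hp : ∀ k, 0 ≤ P.p k)
    (hK : 1 ≤ K) (hK1 : P.p 1 ≤ K) (hKk : P.p (k + 1) ≤ K) (hB : P.Blocking k S)
    (hS : HasDensity S γ) (hφ : ∀ t < P.T, P.failProb k t ≤ φ) (hφ0 : 0 ≤ φ) (hT : 0 < P.T) :
    n * P.mean P.T (wins P.i P.T) / P.T ≤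
      (1 - γ * (k / (k + 1))) / max 1 (γ * (P.p (k + 1) / (k + 1)) + (1 - γ) * P.p 1) +
        (n + 2) * K / P.T + 2 * K * φ := by
  have h1 := mean_wins_le_of_failProb_le hp hB hS hφ
  have h2 := cost_mul_sum_aliveProb_le hp hK1 hKk hB hS hφ
  have h3 := sum_aliveProb_le (P := P) P.T
  have hT' : (0 : ℝ) < P.T := by exact_mod_cast hT
  set X := ∑ t ∈ Finset.range P.T, P.aliveProb t
  set a := γ * (P.p (k + 1) / (k + 1)) + (1 - γ) * P.p 1
  obtain ⟨hκ0, hκ1⟩ := natCast_div_succ_mem k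
  set w := 1 - γ * ((k : ℝ) / (k + 1)) with hw
  have hw0 : 0 ≤ w := by nlinarith
  have hw1 : w ≤ 1 := by nlinarith
  have hE : 0 ≤ (n + 1) * K + K * φ * P.T := by positivity
  -- The survival time is limited both by the horizon (factor 1) and by the budget (factor a).
  have hmax : max 1 a * X ≤ P.T + ((n + 1) * K + K * φ * P.T) := by
    rcases max_cases 1 a with ⟨e, _⟩ | ⟨e, _⟩ <;> rw [e] <;> linarith
  have hm1 : (1 : ℝ) ≤ max 1 a := le_max_left _ _
  have hm0 : 0 < max 1 a := by linarith
  have hX : X ≤ P.T / max 1 a + ((n + 1) * K + K * φ * P.T) := by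
    have : X ≤ (P.T + ((n + 1) * K + K * φ * P.T)) / max 1 a := by
      rw [le_div_iff₀ hm0]; linarith
    rw [add_div] at this
    linarith [div_le_self hE hm1]
  have h4 : w * X ≤ w / max 1 a * P.T + ((n + 1) * K + K * φ * P.T) := by
    have := mul_le_mul_of_nonneg_left hX hw0
    have h5 := mul_le_of_le_one_left hE hw1
    have e : w * (P.T / max 1 a) = w / max 1 a * P.T := by ring
    linarith
  rw [div_le_iff₀ hT']
  have e : (w / max 1 a + (n + 2) * K / P.T + 2 * K * φ) * P.T =
      w / max 1 a * P.T + (n + 2) * K + 2 * K * φ * P.T := by field_simp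
  rw [e]
  have : φ * P.T ≤ K * (φ * P.T) := le_mul_of_one_le_left (by positivity) hK
  linarith

end Plan

/-! ### The optimization program -/

theorem gammaLow_le_one (p : ℕ → ℝ) (k : ℕ) : gammaLow p k ≤ 1 := by
  unfold gammaLow
  split_ifs
  · exact le_rfl
  · exact min_le_left _ _

theorem gammaLow_nonneg {p : ℕ → ℝ} (hp : ∀ k, 0 ≤ p k) (k : ℕ) : 0 ≤ gammaLow p k := by
  unfold gammaLow
  split_ifs
  · exact zero_le_one
  · exact le_min zero_le_one (le_max_of_le_left (one_div_nonneg.2 (hp k)))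

/-- If `γ = gammaLow p k`, the opponents can pay for the fraction `γ` of the rounds, or they run
out of budget no earlier than the agent does. -/
theorem gammaLow_mul_le {p : ℕ → ℝ} (hp : ∀ k, 0 ≤ p k) (k : ℕ) :
    gammaLow p k * p k ≤ 1 ∨ gammaLow p k * p k ≤
      gammaLow p k * (p (k + 1) / (k + 1)) + (1 - gammaLow p k) * p 1 := by
  by_cases h0 : p k = 0
  · left; rw [h0]; simp
  have hpk : 0 < p k := lt_of_le_of_ne (hp k) (Ne.symm h0)
  by_cases hd : p k - p (k + 1) / (k + 1) + p 1 = 0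
  · right
    have : gammaLow p k = 1 := if_pos (Or.inr hd)
    -- The vanishing denominator means p_k = p_{k+1}/(k+1) - p_1, so the second alternative holds at
    -- γ = 1.
    rw [this]; linarith [hp 1]
  have hL : gammaLow p k = min 1 (max (1 / p k) (p 1 / (p k - p (k + 1) / (k + 1) + p 1))) :=
    if_neg (not_or.2 ⟨h0, hd⟩)
  by_cases h1 : gammaLow p k ≤ 1 / p k
  · left; exact (le_div_iff₀ hpk).1 h1
  · right
    have h1 := not_le.1 h1
    have h2 : gammaLow p k ≤ p 1 / (p k - p (k + 1) / (k + 1) + p 1) := by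
      have : gammaLow p k ≤ max (1 / p k) (p 1 / (p k - p (k + 1) / (k + 1) + p 1)) :=
        hL ▸ min_le_right _ _
      exact (le_max_iff.1 this).resolve_left h1.not_ge
    -- The sign of the denominator is not known beforehand; it is positive because the quotient
    -- exceeds 1/p_k > 0.
    have h3 : 0 < p 1 / (p k - p (k + 1) / (k + 1) + p 1) :=
      ((one_div_pos.2 hpk).trans h1).trans_le h2
    have h4 : 0 < p k - p (k + 1) / (k + 1) + p 1 := by
      by_contra hneg
      exact absurd h3 (div_nonpos_of_nonneg_of_nonpos (hp 1) (not_lt.1 hneg)).not_gt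
    have h5 := (le_div_iff₀ h4).1 h2
    linarith

/-- Uses min{1, 1/a} = 1/max{1, a}, which also absorbs the convention for a = 0. -/
theorem objective_eq {p : ℕ → ℝ} (hp : ∀ k, 0 ≤ p k) (k : ℕ) {γ : ℝ} (h0 : 0 ≤ γ) (h1 : γ ≤ 1) :
    objective p k γ = (1 - γ * (k / (k + 1))) /
      max 1 (γ * (p (k + 1) / (k + 1)) + (1 - γ) * p 1) := by
  have e1 : γ / (1 + k) + (1 - γ) = 1 - γ * ((k : ℝ) / (k + 1)) := by
    have : (k : ℝ) + 1 ≠ 0 := by positivity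
    rw [add_comm (1 : ℝ) k]
    field_simp
    ring
  have e2 : p (k + 1) / (k + 1) * γ + p 1 * (1 - γ) = γ * (p (k + 1) / (k + 1)) + (1 - γ) * p 1 := by
    ring
  rw [objective, e1, e2, div_eq_mul_inv]
  congr 1
  have ha : 0 ≤ γ * (p (k + 1) / (k + 1)) + (1 - γ) * p 1 :=
    add_nonneg (mul_nonneg h0 (div_nonneg (hp _) (by positivity)))
      (mul_nonneg (sub_nonneg.2 h1) (hp 1))
  generalize γ * (p (k + 1) / (k + 1)) + (1 - γ) * p 1 = a at ha ⊢
  split_ifs with h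
  · rw [h]; simp
  · have hpos : 0 < a := lt_of_le_of_ne ha (Ne.symm h)
    rcases le_total 1 a with h2 | h2
    · rw [max_eq_right h2, min_eq_right ((div_le_one hpos).2 h2), one_div]
    · rw [max_eq_left h2, min_eq_left ((le_div_iff₀ hpos).2 (by linarith)), inv_one]

theorem objective_le_one {p : ℕ → ℝ} (k : ℕ) {γ : ℝ} (h0 : 0 ≤ γ)
    (h1 : γ ≤ 1) : objective p k γ ≤ 1 := by
  have h2 : γ / (1 + k) ≤ γ := div_le_self h0 (by linarith [(Nat.cast_nonneg k : (0 : ℝ) ≤ k)])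
  have h3 : 0 ≤ γ / (1 + k) := by positivity
  unfold objective
  have h4 : (if p (k + 1) / (k + 1) * γ + p 1 * (1 - γ) = 0 then (1 : ℝ)
     else min 1 (1 / (p (k + 1) / (k + 1) * γ + p 1 * (1 - γ)))) ≤ 1 := by
    split_ifs
    · exact le_rfl
    · exact min_le_left _ _
  calc _ ≤ (γ / (1 + k) + (1 - γ)) * 1 := mul_le_mul_of_nonneg_left h4 (by linarith)
    _ ≤ 1 := by linarith

theorem objective_le_one_of_mem {p : ℕ → ℝ} {k : ℕ} (hp : 0 ≤ p k) {γ : ℝ}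
    (hγ : γ ∈ gammaSet p k) : objective p k γ ≤ 1 := by
  refine objective_le_one k (le_trans ?_ hγ.1) hγ.2.1
  unfold gammaLow
  split_ifs
  · exact zero_le_one
  · exact le_min zero_le_one (le_max_of_le_left (one_div_nonneg.2 hp))

theorem mu_le_one {p : ℕ → ℝ} {k : ℕ} (hp : 0 ≤ p k) : mu p k ≤ 1 := by
  refine Real.sSup_le ?_ zero_le_one
  rintro _ ⟨γ, hγ, rfl⟩
  exact objective_le_one_of_mem hp hγ

/-- The only information about `mu` needed from below: the opponents always play the smallest
admissible γ, and the other candidate merely enlarges the maximum. -/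
theorem objective_gammaLow_le_mu {p : ℕ → ℝ} {k : ℕ} (hp : 0 ≤ p k) :
    objective p k (gammaLow p k) ≤ mu p k := by
  refine le_csSup ⟨1, ?_⟩ ⟨_, ⟨le_rfl, gammaLow_le_one p k, Or.inl rfl⟩, rfl⟩
  rintro _ ⟨γ, hγ, rfl⟩
  exact objective_le_one_of_mem hp hγ

theorem min_mu_le_programValue {p : ℕ → ℝ} (hp : p ∈ priceBox) :
    min (mu p 1) (mu p 2) ≤ programValue := by
  refine le_csSup ⟨1, ?_⟩ ⟨p, hp, rfl⟩
  rintro _ ⟨q, hq, rfl⟩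
  exact min_le_of_left_le (mu_le_one hq.1.le)

/-- The prices (1, 2, 0) witness the bound, with objective 1/2 for k = 1 and 2/3 for k = 2 at
`gammaLow`. Payments outside the main regime can then be treated by any plan that leaves `i` about
half of her ideal utility. -/
theorem half_le_programValue : 1 / 2 ≤ programValue := by
  have he := Real.add_one_le_exp (1 : ℝ)
  let p : ℕ → ℝ := fun k => if k = 1 then 1 else if k = 2 then 2 else 0
  have hbox : p ∈ priceBox := by
    refine ⟨?_, ?_, ?_, ?_, ?_, ?_⟩ <;> simp [p] <;> linarith
  refine le_trans (le_min ?_ ?_) (min_mu_le_programValue hbox)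
  · refine le_trans ?_ (objective_gammaLow_le_mu hbox.1.le)
    have hL : gammaLow p 1 = 1 := by norm_num [gammaLow, p]
    rw [hL]
    norm_num [objective, p]
  · refine le_trans ?_ (objective_gammaLow_le_mu hbox.2.2.1)
    have hL : gammaLow p 2 = 1 / 2 := by norm_num [gammaLow, p]
    rw [hL]
    norm_num [objective, p]

/-- The objective is Lipschitz along shrinking `γ`. -/
theorem shrunk_objective_le {K ε γ κ q p₁ : ℝ} (hK : 0 ≤ K) (hε0 : 0 ≤ ε) (hγ0 : 0 ≤ γ)
    (hγ1 : γ ≤ 1) (hκ0 : 0 ≤ κ) (hκ1 : κ ≤ 1) (hqK : q ≤ K) (hp₁ : 0 ≤ p₁) :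
    (1 - (1 - ε) * γ * κ) / max 1 ((1 - ε) * γ * q + (1 - (1 - ε) * γ) * p₁) ≤
      (1 - γ * κ) / max 1 (γ * q + (1 - γ) * p₁) + (K + 1) * ε := by
  set a := γ * q + (1 - γ) * p₁ with ha
  set a' := (1 - ε) * γ * q + (1 - (1 - ε) * γ) * p₁ with ha'
  have hεγ : ε * γ ≤ ε := mul_le_of_le_one_right hε0 hγ1
  have hεγ0 : 0 ≤ ε * γ := mul_nonneg hε0 hγ0
  have h1 : a ≤ a' + K * ε := by
    have h2 : ε * γ * (q - p₁) ≤ ε * γ * K := mul_le_mul_of_nonneg_left (by linarith) hεγ0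
    have h3 : ε * γ * K ≤ ε * K := mul_le_mul_of_nonneg_right hεγ hK
    have e : a = a' + ε * γ * (q - p₁) := by rw [ha, ha']; ring
    linarith
  have hm : max 1 a ≤ max 1 a' + K * ε := by
    refine max_le ?_ ?_
    · linarith [le_max_left 1 a', mul_nonneg hK hε0]
    · linarith [le_max_right 1 a']
  have hA : (1 : ℝ) ≤ max 1 a := le_max_left _ _
  have hA' : (1 : ℝ) ≤ max 1 a' := le_max_left _ _
  generalize max 1 a = A at *
  generalize max 1 a' = A' at *
  have hγκ : γ * κ ≤ 1 := mul_le_one₀ hγ1 hκ0 hκ1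
  have hγκ0 : 0 ≤ γ * κ := mul_nonneg hγ0 hκ0
  have hw0 : 0 ≤ 1 - γ * κ := by linarith
  have hKε : 0 ≤ K * ε := mul_nonneg hK hε0
  have h5 : (1 - γ * κ) / A' ≤ (1 - γ * κ) / A + K * ε := by
    rw [div_le_iff₀ (by linarith), add_mul, div_mul_eq_mul_div]
    have h6 : 1 - γ * κ - K * ε ≤ (1 - γ * κ) * A' / A := by
      rw [le_div_iff₀ (by linarith)]
      have := mul_le_mul_of_nonneg_left hm hw0
      have h7 : (1 - γ * κ) * (K * ε) ≤ 1 * (K * ε) :=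
        mul_le_mul_of_nonneg_right (by linarith) hKε
      have h8 : K * ε * 1 ≤ K * ε * A := mul_le_mul_of_nonneg_left hA hKε
      linarith
    have h9 : K * ε * 1 ≤ K * ε * A' := mul_le_mul_of_nonneg_left hA' hKε
    linarith
  have h10 : (1 - (1 - ε) * γ * κ) / A' = (1 - γ * κ) / A' + ε * (γ * κ) / A' := by
    rw [← add_div]; ring
  have h11 : ε * (γ * κ) / A' ≤ ε :=
    (div_le_self (mul_nonneg hε0 hγκ0) hA').trans (mul_le_of_le_one_right hε0 hγκ)
  rw [h10]
  linarith

namespace Plan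

variable {n : ℕ} {P : Plan n} {k : ℕ} {S : ℕ → ℕ}

/-! ### The opponents do not bid -/

/-- Left alone, `i` pays p_1 for each win and can afford at most half of the wins that T rounds
would give her, up to one overshooting payment. -/
theorem wins_fraction_le_of_idle (hp : ∀ k, 0 ≤ P.p k) (hp1 : 2 ≤ P.p 1)
    (hB : P.Blocking 0 fun _ => 0) (hT : 0 < P.T) :
    n * P.mean P.T (wins P.i P.T) / P.T ≤ 1 / 2 + n / P.T := by
  have hS : IsSchedule fun _ => 0 := ⟨rfl, fun _ => Or.inl rfl⟩
  have h1 := mean_wins_le hB hS P.T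
  have h2 := sum_cost_le (K := P.p 1) hp le_rfl le_rfl hB hS P.T
  simp only [sub_self, zero_mul, sub_zero, one_mul, zero_add, add_zero, ← Finset.mul_sum] at h1 h2
  have hT' : (0 : ℝ) < P.T := by exact_mod_cast hT
  have h3 : ∑ t ∈ Finset.range P.T, P.aliveProb t ≤ P.T / 2 + n := by
    have h4 : ∑ t ∈ Finset.range P.T, P.aliveProb t ≤ P.T / P.p 1 + n := by
      have h5 : 0 < P.p 1 := by linarith
      have e : (P.T : ℝ) / P.p 1 + n = (P.T + n * P.p 1) / P.p 1 := by field_simp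
      rw [e, le_div_iff₀ h5]; linarith
    have : (P.T : ℝ) / P.p 1 ≤ P.T / 2 := div_le_div_of_nonneg_left hT'.le two_pos hp1
    linarith
  rw [div_le_iff₀ hT']
  have e : (1 / 2 + (n : ℝ) / P.T) * P.T = P.T / 2 + n := by field_simp
  linarith

/-! ### Expensive collisions -/

theorem failProb_le_aliveProb (k t : ℕ) : P.failProb k t ≤ P.aliveProb t := by
  refine mean_mono fun h _ => mul_le_of_le_one_right (alive_nonneg h) ?_
  unfold failing; split_ifs <;> norm_num

/-- The time during which `i` and the opponents are both active is bounded by what `i` can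
afford, however large the price of a collision is. -/
theorem sum_active_le {q : ℝ} (hk : k ≠ 0) (hq : 0 < q) (hp : ∀ k, 0 ≤ P.p k)
    (hqk : q ≤ P.p (k + 1) / (k + 1)) (hB : P.Blocking k S) (hS : ∀ t, S (t + 1) = S t + 1)
    (hT : 0 < P.T) :
    ∑ t ∈ Finset.range P.T, (P.aliveProb t - P.failProb k t) ≤ P.T / q + 2 * (k + 1) * n := by
  have hn : (0 : ℝ) < n := by exact_mod_cast Fin.pos P.i
  have hT' : (0 : ℝ) < P.T := by exact_mod_cast hT
  have hk1 : (0 : ℝ) < k + 1 := by positivity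
  have h1 : 1 / ((k : ℝ) + 1) * ∑ t ∈ Finset.range P.T, (P.aliveProb t - P.failProb k t) ≤
      n * P.mean P.T (P.contestedWins P.T) := by
    rw [contestedWins, mean_total, Finset.mul_sum, Finset.mul_sum]
    refine Finset.sum_le_sum fun t _ => ?_
    have e : ∀ h : Fin t → Round n, P.stepMean (1 / n) h
        (fun r => if r.2 = some P.i then (if 1 < r.1.card then 1 else 0) else 0) =
        1 / n * (P.alive h * ((if 1 < (P.act t h).card + 1 then 1 else 0) /
          ((P.act t h).card + 1))) := fun h =>
      stepMean_own hB.admissible _ h fun c => if 1 < c then 1 else 0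
    simp only [e]
    rw [mean_mul, natCast_mul_one_div P.i, sub_eq_add_neg, ← neg_one_mul, aliveProb, failProb,
      ← mean_mul, ← mean_add, ← mean_mul]
    refine mean_mono fun h _ => ?_
    rw [hB.card_act, hS]
    have hkpos := Nat.pos_of_ne_zero hk
    unfold failing
    by_cases hs : k ≤ (P.solvent h).card
    · simp [hs, hkpos, mul_comm]
    · simp [hs]
  set c := P.collisionCost k with hc
  have hc0 : 0 < c := by
    have h2 : 0 < P.p (k + 1) := by
      have := hq.trans_le hqk
      exact pos_of_mul_pos_left (by rwa [div_eq_mul_inv] at this) (by positivity)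
    exact lt_min h2 (by positivity)
  have h2 : c * P.mean P.T (P.contestedWins P.T) ≤ P.T / n + c := by
    rw [← mean_mul]
    exact mean_le_of_le fun h hr => (contestedWins_mul_le hc0.le (min_le_left _ _) hp hB hr).2
  set Y := ∑ t ∈ Finset.range P.T, (P.aliveProb t - P.failProb k t)
  have h3 : c * Y ≤ (k + 1) * (P.T + n * c) := by
    have h4 := mul_le_mul_of_nonneg_left h1 (show 0 ≤ c * (k + 1) by positivity)
    have h5 := mul_le_mul_of_nonneg_left h2 (show 0 ≤ (k + 1 : ℝ) * n by positivity)
    have e1 : c * (k + 1) * (1 / ((k : ℝ) + 1) * Y) = c * Y := by field_simp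
    have e2 : ((k : ℝ) + 1) * n * (P.T / n + c) = (k + 1) * (P.T + n * c) := by field_simp
    linarith
  have h6 : (k + 1) * (P.T : ℝ) ≤ c * (P.T / q + (k + 1) * n) := by
    rcases min_cases (P.p (k + 1)) (P.T / n : ℝ) with ⟨e, _⟩ | ⟨e, _⟩
    · rw [hc, collisionCost, e]
      rw [le_div_iff₀ hk1] at hqk
      have h7 := mul_le_mul_of_nonneg_right hqk (show 0 ≤ (P.T : ℝ) / q by positivity)
      have e3 : q * (k + 1) * ((P.T : ℝ) / q) = (k + 1) * P.T := by field_simp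
      have h8 : 0 ≤ P.p (k + 1) * ((k + 1) * n) := mul_nonneg (hp _) (by positivity)
      linarith
    · rw [hc, collisionCost, e]
      have e3 : (P.T : ℝ) / n * ((k + 1) * n) = (k + 1) * P.T := by field_simp
      have h8 : 0 ≤ (P.T : ℝ) / n * (P.T / q) := by positivity
      linarith
  refine le_of_mul_le_mul_left (a := c) ?_ hc0
  linarith

/-- If the price of a collision is large compared to what `k` opponents pay among themselves, they
exhaust `i` early by bidding in all rounds. -/
theorem wins_fraction_le_of_expensive {q M ε : ℝ} (hk : k ≠ 0) (hq : 1 ≤ q) (hM : 1 ≤ M)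
    (hMq : M - k / (k + 1) ≤ q / 2) (hε : 0 < ε) (hε1 : ε ≤ 1 / 4) (hp : ∀ k, 0 ≤ P.p k)
    (hpk : P.p k ≤ M) (hqk : q ≤ P.p (k + 1) / (k + 1)) (hB : P.Blocking k fun t => t)
    (hkn : k ≤ ε / 2 * n) (hMT : M ≤ ε * P.T) :
    n * P.mean P.T (wins P.i P.T) / P.T ≤
      1 / 2 + 4 * M * ε + 3 * M * (2 * (k + 1) * n / P.T + 4 * k / (ε * n)) := by
  have hn : (0 : ℝ) < n := by exact_mod_cast Fin.pos P.i
  have hS : IsSchedule fun t => t := ⟨rfl, fun _ => Or.inr rfl⟩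
  have hT' : (0 : ℝ) < P.T := pos_of_mul_pos_right (by linarith) hε.le
  have hT : 0 < P.T := by exact_mod_cast hT'
  have hκ : (k : ℝ) / (k + 1) = 1 - 1 / (k + 1) := by field_simp; ring
  have hk1 : 0 ≤ 1 / ((k : ℝ) + 1) ∧ 1 / ((k : ℝ) + 1) ≤ 1 :=
    ⟨by positivity, by rw [div_le_one (by positivity)]; linarith [(Nat.cast_nonneg k : (0 : ℝ) ≤ k)]⟩
  set φ := 4 * (k : ℝ) / (ε * n) with hφ
  have hφ0 : 0 ≤ φ := by positivity
  set b := 1 / ((k : ℝ) + 1) with hb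
  -- Up to this time the opponents can pay for winning every round alone, with a reserve εT for
  -- collisions.
  set T₀ := ⌊(1 - ε) * P.T / M⌋₊ with hT₀
  have hT₀le : (T₀ : ℝ) ≤ (1 - ε) * P.T / M :=
    Nat.floor_le (div_nonneg (mul_nonneg (by linarith) hT'.le) (by linarith))
  have hMT₀ : M * T₀ ≤ (1 - ε) * P.T := by
    rw [le_div_iff₀ (by linarith)] at hT₀le; linarith
  have hT₀T : T₀ ≤ P.T := by
    have h1 : (T₀ : ℝ) ≤ P.T := by
      have := le_mul_of_one_le_left (Nat.cast_nonneg T₀ : (0 : ℝ) ≤ T₀) hM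
      have := mul_nonneg hε.le hT'.le
      linarith
    exact_mod_cast h1
  have hTT₀ : (P.T : ℝ) ≤ M * (1 + 4 * ε) * T₀ := by
    have h1 := Nat.lt_floor_add_one ((1 - ε) * P.T / M)
    rw [div_lt_iff₀ (by linarith)] at h1
    have h2 : (1 - ε) * P.T - M ≤ M * T₀ := by linarith
    have h3 : (1 - ε) * P.T - ε * P.T ≤ M * T₀ := by linarith
    have h4 := mul_le_mul_of_nonneg_left h3 (show 0 ≤ 1 + 4 * ε by linarith)
    have h5 : 0 ≤ ε * (1 - 4 * ε) * P.T := by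
      have : 0 ≤ 1 - 4 * ε := by linarith
      positivity
    have h6 : 0 ≤ ε * P.T := by positivity
    linarith
  have hT₀pos : (0 : ℝ) < T₀ := by
    have : 0 < M * (1 + 4 * ε) * T₀ := hT'.trans_le hTT₀
    exact pos_of_mul_pos_right this (by positivity)
  have hfail : ∀ t < T₀, P.failProb k t ≤ φ := fun t ht => by
    refine failProb_le_of_spending hε hp hB hS hT hkn ?_
    have h1 : (t : ℝ) ≤ T₀ := by exact_mod_cast ht.le
    have h2 := mul_le_mul_of_nonneg_left h1 (hp k)
    have h3 := mul_le_mul_of_nonneg_right hpk hT₀pos.le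
    linarith
  set Y := ∑ t ∈ Finset.range T₀, P.aliveProb t with hY
  have hYle : Y ≤ P.T / q + 2 * (k + 1) * n + φ * P.T := by
    have h1 := sum_active_le hk (by linarith) hp hqk hB (fun _ => rfl) hT
    have h2 : ∑ t ∈ Finset.range T₀, (P.aliveProb t - P.failProb k t) ≤
        ∑ t ∈ Finset.range P.T, (P.aliveProb t - P.failProb k t) :=
      Finset.sum_le_sum_of_subset_of_nonneg (Finset.range_mono hT₀T)
        fun t _ _ => sub_nonneg.2 (failProb_le_aliveProb k t)
    have h3 : ∑ t ∈ Finset.range T₀, P.failProb k t ≤ φ * P.T := by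
      calc _ ≤ ∑ t ∈ Finset.range T₀, φ :=
            Finset.sum_le_sum fun t ht => hfail t (Finset.mem_range.1 ht)
        _ = T₀ * φ := by simp
        _ ≤ P.T * φ := mul_le_mul_of_nonneg_right (by exact_mod_cast hT₀T) hφ0
        _ = _ := mul_comm _ _
    rw [Finset.sum_sub_distrib] at h2
    linarith
  have hY0 : 0 ≤ Y := Finset.sum_nonneg fun t _ => aliveProb_nonneg t
  -- Survival probabilities decrease, so a short expected survival time before T₀ also bounds the
  -- probability of surviving T₀, and with it all later wins.
  have hxT₀ : T₀ * P.aliveProb T₀ ≤ Y := by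
    calc _ = ∑ t ∈ Finset.range T₀, P.aliveProb T₀ := by simp
      _ ≤ Y := Finset.sum_le_sum fun t ht => antitone_aliveProb hp (Finset.mem_range.1 ht).le
  have hwin := mean_wins_le hB hS P.T
  have hsplit : n * P.mean P.T (wins P.i P.T) ≤ b * Y + φ * P.T + (P.T - T₀) * P.aliveProb T₀ := by
    refine hwin.trans ?_
    have e : ∀ t : ℕ, ((t + 1 : ℕ) : ℝ) - t = 1 := fun t => by push_cast; ring
    simp only [e, one_mul, hκ, sub_sub_cancel]
    rw [← Finset.sum_range_add_sum_Ico _ hT₀T]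
    have h1 : ∑ t ∈ Finset.range T₀, (b * P.aliveProb t + (1 - b) * P.failProb k t) ≤
        b * Y + φ * P.T := by
      calc _ ≤ ∑ t ∈ Finset.range T₀, (b * P.aliveProb t + φ) := by
            refine Finset.sum_le_sum fun t ht => add_le_add le_rfl ?_
            refine (mul_le_of_le_one_left (failProb_nonneg _ _) (by linarith)).trans ?_
            exact hfail t (Finset.mem_range.1 ht)
        _ = b * Y + T₀ * φ := by rw [Finset.sum_add_distrib, ← Finset.mul_sum, Finset.sum_const, Finset.card_range,
            nsmul_eq_mul]
        _ ≤ _ := by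
          have := mul_le_mul_of_nonneg_right
            (show (T₀ : ℝ) ≤ P.T by exact_mod_cast hT₀T) hφ0
          linarith
    have h2 : ∑ t ∈ Finset.Ico T₀ P.T, (b * P.aliveProb t + (1 - b) * P.failProb k t) ≤
        (P.T - T₀) * P.aliveProb T₀ := by
      calc _ ≤ ∑ t ∈ Finset.Ico T₀ P.T, P.aliveProb T₀ := by
            refine Finset.sum_le_sum fun t ht => ?_
            have h3 := antitone_aliveProb hp (Finset.mem_Ico.1 ht).1
            have h4 := mul_le_mul_of_nonneg_left (failProb_le_aliveProb (P := P) k t)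
              (sub_nonneg.2 hk1.2)
            linarith
        _ = _ := by simp [Nat.cast_sub hT₀T]
    linarith
  have hx : P.T * P.aliveProb T₀ ≤ M * (1 + 4 * ε) * Y := by
    have h1 := mul_le_mul_of_nonneg_right hTT₀ (aliveProb_nonneg (P := P) T₀)
    have h2 := mul_le_mul_of_nonneg_left hxT₀ (show 0 ≤ M * (1 + 4 * ε) by positivity)
    linarith
  have hx' : (P.T - T₀) * P.aliveProb T₀ ≤ (M * (1 + 4 * ε) - 1) * Y := by
    have h3 : M * (1 + 4 * ε) * (T₀ * P.aliveProb T₀) ≤ M * (1 + 4 * ε) * Y :=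
      mul_le_mul_of_nonneg_left hxT₀ (by positivity)
    have h4 : (P.T - T₀ : ℝ) * P.aliveProb T₀ ≤
        (M * (1 + 4 * ε) * T₀ - T₀) * P.aliveProb T₀ :=
      mul_le_mul_of_nonneg_right (by linarith) (aliveProb_nonneg T₀)
    have h5 : 0 ≤ M * (1 + 4 * ε) - 1 := by
      have : 0 ≤ M * (4 * ε) := by positivity
      linarith
    have h6 := mul_le_mul_of_nonneg_left hxT₀ h5
    linarith
  -- Each unit of survival time before T₀ yields b directly and at most T/T₀ - 1 afterwards, with
  -- T/T₀ ≤ M(1 + 4ε). Up to ε this is M - k/(k+1) ≤ q/2, which balances Y ≈ T/q to give T/2.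
  set D := M * (1 + 4 * ε) - 1 + b with hD
  have hDle : D ≤ q / 2 + 4 * M * ε := by rw [hκ] at hMq; rw [hD]; linarith
  have hD2 : D ≤ 2 * M := by
    have : M * (4 * ε) ≤ M * 1 := mul_le_mul_of_nonneg_left (by linarith) (by linarith)
    rw [hD]; linarith [hk1.2]
  have hD0 : 0 ≤ D := by
    have : 0 ≤ M * (4 * ε) := by positivity
    rw [hD]; linarith [hk1.1]
  have hfin : n * P.mean P.T (wins P.i P.T) ≤ D * Y + φ * P.T := by
    rw [hD]; linarith
  have h1 : D * Y ≤ D * (P.T / q) + 2 * M * (2 * (k + 1) * n + φ * P.T) := by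
    have h2 := mul_le_mul_of_nonneg_left hYle hD0
    have h3 := mul_le_mul_of_nonneg_right hD2 (show 0 ≤ 2 * ((k : ℝ) + 1) * n + φ * P.T by positivity)
    linarith
  have h2 : D * (P.T / q) ≤ (1 / 2 + 4 * M * ε) * P.T := by
    have h3 := mul_le_mul_of_nonneg_right hDle (show 0 ≤ (P.T : ℝ) / q by positivity)
    have e : (q / 2 + 4 * M * ε) * ((P.T : ℝ) / q) = P.T / 2 + 4 * M * ε * (P.T / q) := by
      field_simp
    have h4 : 4 * M * ε * (P.T / q) ≤ 4 * M * ε * P.T :=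
      mul_le_mul_of_nonneg_left (div_le_self hT'.le hq) (by positivity)
    linarith
  rw [div_le_iff₀ hT']
  have e : (1 / 2 + 4 * M * ε + 3 * M * (2 * (k + 1) * n / P.T + φ)) * P.T =
      (1 / 2 + 4 * M * ε) * P.T + 3 * M * (2 * (k + 1) * n + φ * P.T) := by field_simp
  rw [e]
  have h5 : φ * P.T ≤ M * (φ * P.T) := le_mul_of_one_le_left (by positivity) hM
  have h6 : 0 ≤ M * (2 * (k + 1) * n) := by positivity
  linarith

end Plan

/-! ### Cheap rounds, and contesting the fraction `gammaLow` -/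

namespace Plan

variable {n : ℕ} {P : Plan n} {k : ℕ} {S : ℕ → ℕ}

/-- One opponent can contest almost all rounds if winning them alone is cheap. -/
theorem wins_fraction_le_of_cheap {ε : ℝ} (hε : 0 < ε) (hε1 : ε ≤ 1) (hp : ∀ k, 0 ≤ P.p k)
    (hp1 : P.p 1 ≤ 1) (hB : P.Blocking 1 S) (hS : HasDensity S (1 - ε)) (hT : 0 < P.T)
    (hn : 1 ≤ ε / 2 * n) :
    n * P.mean P.T (wins P.i P.T) / P.T ≤ 1 / 2 + ε / 2 + 1 / P.T + 4 / (ε * n) := by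
  have hT' : (0 : ℝ) < P.T := by exact_mod_cast hT
  have hφ : ∀ t < P.T, P.failProb 1 t ≤ 4 / (ε * n) := fun t ht => by
    have h1 := failProb_le_of_spending hε hp hB hS.toIsSchedule hT (by simpa using hn) (t := t) (by
      have h2 := hS.le t
      have h3 : (1 - ε) * (t : ℝ) ≤ (1 - ε) * P.T :=
        mul_le_mul_of_nonneg_left (by exact_mod_cast ht.le) (by linarith)
      exact (mul_le_of_le_one_left (Nat.cast_nonneg _) hp1).trans (h2.trans h3))
    simpa using h1
  have h1 := mean_wins_le_of_failProb_le hp hB hS hφ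
  have h2 := sum_aliveProb_le (P := P) P.T
  have e : 1 - (1 - ε) * (((1 : ℕ) : ℝ) / ((1 : ℕ) + 1)) = 1 / 2 + ε / 2 := by norm_num; ring
  rw [e] at h1
  have h3 := mul_le_mul_of_nonneg_left h2 (show 0 ≤ 1 / 2 + ε / 2 by positivity)
  rw [div_le_iff₀ hT']
  have e2 : (1 / 2 + ε / 2 + 1 / P.T + 4 / (ε * n)) * (P.T : ℝ) =
      (1 / 2 + ε / 2) * P.T + 1 + 4 / (ε * n) * P.T := by field_simp
  linarith

/-- Contesting the fraction `gammaLow p k` of the rounds keeps `i` down to the objective. -/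
theorem wins_fraction_le_objective {ε K η : ℝ} (hε : 0 < ε) (hε1 : ε ≤ 1) (hK : 1 ≤ K)
    (hη : η = ε / (16 * K)) (hp : ∀ k, 0 ≤ P.p k) (hp1 : 1 ≤ P.p 1)
    (hK1 : P.p 1 ≤ K) (hKk : P.p k ≤ K) (hKk' : P.p (k + 1) ≤ K) (hB : P.Blocking k S)
    (hS : HasDensity S ((1 - ε) * gammaLow P.p k)) (hkn : k ≤ η * n) (hKT : K ≤ η * P.T) :
    n * P.mean P.T (wins P.i P.T) / P.T ≤ objective P.p k (gammaLow P.p k) + (K + 1) * ε +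
      (n + 2) * K / P.T + 2 * K * (4 * k / (η * n) + n * K ^ 2 / (η ^ 2 * P.T)) := by
  have hn : (0 : ℝ) < n := by exact_mod_cast Fin.pos P.i
  have hη0 : 0 < η := by rw [hη]; positivity
  have hT' : (0 : ℝ) < P.T := pos_of_mul_pos_right (by linarith) hη0.le
  have hT : 0 < P.T := by exact_mod_cast hT'
  have hηε : η ≤ ε / 2 := by
    rw [hη, div_le_div_iff₀ (by positivity) two_pos]
    exact mul_le_mul_of_nonneg_left (by linarith) hε.le
  set γ := gammaLow P.p k with hγ
  have hγ0 : 0 ≤ γ := gammaLow_nonneg hp k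
  have hγ1 : γ ≤ 1 := gammaLow_le_one P.p k
  have hγ0' : 0 ≤ (1 - ε) * γ := mul_nonneg (by linarith) hγ0
  have hγ1' : (1 - ε) * γ ≤ 1 := mul_le_one₀ (by linarith) hγ0 hγ1
  have hφ0 : 0 ≤ 4 * (k : ℝ) / (η * n) + n * K ^ 2 / (η ^ 2 * P.T) := by positivity
  have hφ : ∀ t < P.T, P.failProb k t ≤ 4 * (k : ℝ) / (η * n) + n * K ^ 2 / (η ^ 2 * P.T) := by
    intro t ht
    rcases gammaLow_mul_le hp k with h1 | h1
    · have h2 := failProb_le_of_spending (t := t) hε hp hB hS.toIsSchedule hT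
        (hkn.trans (mul_le_mul_of_nonneg_right hηε hn.le)) (by
          have h3 := mul_le_mul_of_nonneg_left (hS.le t) (hp k)
          have h4 : (1 - ε) * (gammaLow P.p k * P.p k) * t ≤ (1 - ε) * 1 * P.T := by
            refine mul_le_mul (mul_le_mul_of_nonneg_left h1 (by linarith))
              (by exact_mod_cast ht.le) (Nat.cast_nonneg t) (by linarith)
          linarith)
      have h5 : 4 * (k : ℝ) / (ε * n) ≤ 4 * k / (η * n) :=
        div_le_div_of_nonneg_left (by positivity) (by positivity)
          (mul_le_mul_of_nonneg_right (by linarith) hn.le)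
      have h6 : 0 ≤ n * K ^ 2 / (η ^ 2 * P.T) := by positivity
      linarith
    -- Shrinking γ turns contested rounds into rounds where `i` pays p_1 alone: multiplying the
    -- inequality by 1 - ε leaves a surplus ε p_1 ≥ ε in her favoured spending rate. This is where
    -- p_1 ≥ 1 is needed.
    · have h2 := failProb_le_of_race hε hε1 hK hη hγ1' hp hK1 hKk hKk' hB hS (by
          have h3 := mul_le_mul_of_nonneg_left h1 (show 0 ≤ 1 - ε by linarith)
          have h4 := le_mul_of_one_le_right hε.le hp1
          linarith) hkn hKT ht.le
      have h5 : 2 * (k : ℝ) / (η * n) ≤ 4 * k / (η * n) :=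
        div_le_div_of_nonneg_right (by linarith [(Nat.cast_nonneg k : (0 : ℝ) ≤ k)]) (by positivity)
      linarith
  have h1 := wins_fraction_le hγ0' hγ1' hp hK hK1 hKk' hB hS hφ hφ0 hT
  obtain ⟨hκ0, hκ1⟩ := natCast_div_succ_mem k
  have h2 := shrunk_objective_le (K := K) (ε := ε) (γ := γ) (κ := (k : ℝ) / (k + 1))
    (q := P.p (k + 1) / (k + 1)) (p₁ := P.p 1) (by linarith) hε.le hγ0 hγ1 hκ0 hκ1
    ((div_le_self (hp _) (by linarith [(Nat.cast_nonneg k : (0 : ℝ) ≤ k)])).trans hKk') (hp 1)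
  rw [objective_eq hp k hγ0 hγ1]
  linarith

end Plan

/-! ### Choice of the plan according to the payments -/

/-- For large `n` and `T` there is, whatever the payments are, a plan of the opponents that keeps
an aggressive agent down to the value of the program. -/
theorem exists_plan {δ : ℝ} (hδ : 0 < δ) : ∃ n : ℕ, 2 ≤ n ∧ ∃ T₀ : ℕ, ∀ T : ℕ, T₀ ≤ T →
    ∀ p : ℕ → ℝ, (∀ k, 0 ≤ p k) → ∀ i : Fin n, ∃ P : Plan n, P.T = T ∧ P.p = p ∧ P.i = i ∧
      P.Admissible ∧ n * P.mean P.T (Plan.wins P.i P.T) / P.T ≤ programValue + δ := by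
  -- The factor 200 is generous. The largest loss is (40 + 1)ε, from shrinking `gammaLow` with all
  -- relevant payments at most 40.
  obtain ⟨ε, hε, hε1, hεδ⟩ : ∃ ε : ℝ, 0 < ε ∧ ε ≤ 1 / 4 ∧ 200 * ε ≤ δ :=
    ⟨min (1 / 4) (δ / 200), by positivity, min_le_left _ _, by linarith [min_le_right (1 / 4) (δ / 200)]⟩
  obtain ⟨η, hη⟩ : ∃ η : ℝ, η = ε / (16 * 40) := ⟨_, rfl⟩
  have hη0 : 0 < η := by rw [hη]; positivity
  have hηε : η ≤ ε / 2 := by rw [hη]; linarith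
  -- The collision costs give failure probabilities of order 1/n, so n is fixed first; all other
  -- errors are of order 1/T for fixed n.
  obtain ⟨n, hn⟩ := exists_nat_ge (8 / (η * (ε / 80)) + 2)
  have hn0 : 0 ≤ 8 / (η * (ε / 80)) := by positivity
  have hn2 : (2 : ℝ) ≤ n := by linarith
  have hnpos : (0 : ℝ) < n := by linarith
  have hnη : 8 / (η * n) ≤ ε / 80 := by
    have h1 : 8 / (η * (ε / 80)) ≤ n := by linarith
    rw [div_le_iff₀ (by positivity)] at h1 ⊢
    linarith
  have hnη8 : 8 ≤ η * n := by
    rw [div_le_iff₀ (by positivity)] at hnη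
    have : ε / 80 * (η * n) ≤ 1 * (η * n) := mul_le_mul_of_nonneg_right (by linarith) (by positivity)
    linarith
  have hnε : 8 / (ε * n) ≤ ε / 80 :=
    (div_le_div_of_nonneg_left (by norm_num) (by positivity)
      (mul_le_mul_of_nonneg_right (by linarith) hnpos.le)).trans hnη
  obtain ⟨T₀, hT₀⟩ := exists_nat_ge
    (n * 40 ^ 2 / (η ^ 2 * (ε / 80)) + (n + 2) * 40 / (ε / 80) + 40 / η + 1)
  refine ⟨n, by exact_mod_cast hn2, T₀, fun T hT p hp i => ?_⟩
  have hTT₀ : (T₀ : ℝ) ≤ T := by exact_mod_cast hT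
  have hA : 0 ≤ n * 40 ^ 2 / (η ^ 2 * (ε / 80)) := by positivity
  have hC : 0 ≤ (n + 2) * 40 / (ε / 80) := by positivity
  have hD : 0 ≤ 40 / η := by positivity
  have hTpos : (0 : ℝ) < T := by linarith
  have hTpos' : 0 < T := by exact_mod_cast hTpos
  have hT1 : n * 40 ^ 2 / (η ^ 2 * T) ≤ ε / 80 := by
    have h1 : n * 40 ^ 2 / (η ^ 2 * (ε / 80)) ≤ T := by linarith
    rw [div_le_iff₀ (by positivity)] at h1 ⊢
    linarith
  have hT2 : (n + 2) * 40 / T ≤ ε / 80 := by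
    have h1 : (n + 2) * 40 / (ε / 80) ≤ T := by linarith
    rw [div_le_iff₀ (by positivity)] at h1 ⊢
    linarith
  have hT3 : 40 ≤ η * T := by
    have h1 : 40 / η ≤ T := by linarith
    rw [div_le_iff₀ hη0] at h1
    linarith
  have hnT : n / T ≤ ε / 80 := by
    refine le_trans (div_le_div_of_nonneg_right ?_ hTpos.le) hT2
    linarith
  have hhalf := half_le_programValue
  have hV : ∀ k : ℕ, k ≤ 2 → 4 * (k : ℝ) / (ε * n) ≤ ε / 80 := fun k hk => by
    refine le_trans (div_le_div_of_nonneg_right ?_ (by positivity)) hnε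
    have : (k : ℝ) ≤ 2 := by exact_mod_cast hk
    linarith
  rcases le_total (p 1) 1 with hp1 | hp1
  · obtain ⟨P, rfl, rfl, rfl, hB⟩ := Plan.exists_blocking T p i 1 fun t => ⌊(1 - ε) * t⌋₊
    refine ⟨P, rfl, rfl, rfl, hB.admissible, ?_⟩
    have h1 := Plan.wins_fraction_le_of_cheap hε (by linarith) hp hp1 hB
      (Plan.hasDensity_floor (by linarith) (by linarith)) hTpos' (by
        have := mul_le_mul_of_nonneg_right hηε hnpos.le
        linarith)
    have h2 := hV 1 (by norm_num)
    have h3 : 1 / (P.T : ℝ) ≤ n / P.T := div_le_div_of_nonneg_right (by linarith) hTpos.le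
    simp only [Nat.cast_one, mul_one] at h2
    linarith
  rcases le_total 2 (p 1) with hp2 | hp2
  · obtain ⟨P, rfl, rfl, rfl, hB⟩ := Plan.exists_blocking T p i 0 fun _ => 0
    refine ⟨P, rfl, rfl, rfl, hB.admissible, ?_⟩
    have h1 := Plan.wins_fraction_le_of_idle hp hp2 hB hTpos'
    linarith
  have expensive : ∀ (k : ℕ) (q M : ℝ), k ≠ 0 → k ≤ 2 → 1 ≤ q → 1 ≤ M → M ≤ 6 →
      M - k / (k + 1) ≤ q / 2 → p k ≤ M → q ≤ p (k + 1) / (k + 1) →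
      ∃ P : Plan n, P.T = T ∧ P.p = p ∧ P.i = i ∧
      P.Admissible ∧ n * P.mean P.T (Plan.wins P.i P.T) / P.T ≤ programValue + δ := by
    intro k q M hk hk2 hq hM hM6 hMq hpk hqk
    obtain ⟨P, rfl, rfl, rfl, hB⟩ := Plan.exists_blocking T p i k fun t => t
    refine ⟨P, rfl, rfl, rfl, hB.admissible, ?_⟩
    have hk2' : (k : ℝ) ≤ 2 := by exact_mod_cast hk2
    have h1 := Plan.wins_fraction_le_of_expensive hk hq hM hMq hε hε1 hp hpk hqk hB (by
        have := mul_le_mul_of_nonneg_right hηε hnpos.le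
        linarith) (by
        have := mul_le_mul_of_nonneg_right hηε hTpos.le
        linarith)
    have h2 := hV k hk2
    have h3 : 2 * ((k : ℝ) + 1) * n / P.T ≤ ε / 80 * 6 := by
      have e : 2 * ((k : ℝ) + 1) * n / P.T = 2 * (k + 1) * (n / P.T) := by ring
      rw [e]
      have : 2 * ((k : ℝ) + 1) * (n / P.T) ≤ 6 * (n / P.T) :=
        mul_le_mul_of_nonneg_right (by linarith) (by positivity)
      linarith
    have h4 : 4 * M * ε ≤ 24 * ε := mul_le_mul_of_nonneg_right (by linarith) hε.le
    have h5 : 3 * M * (2 * (k + 1) * n / P.T + 4 * k / (ε * n)) ≤ 18 * (ε / 80 * 6 + ε / 80) :=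
      mul_le_mul (by linarith) (by linarith) (by positivity) (by norm_num)
    linarith
  have he := Real.exp_one_gt_d9
  have he' := Real.exp_one_lt_d9
  rcases le_total 6 (p 2) with h2 | h2
  -- The thresholds 6 here and 32 below make M - k/(k+1) = q/2 exact: 2 - 1/2 = 3/2, and 6 - 2/3 =
  -- 16/3.
  · exact expensive 1 3 2 (by norm_num) (by norm_num) (by norm_num) (by norm_num) (by norm_num)
      (by norm_num) hp2 (by norm_num; linarith)
  rcases le_total 32 (p 3) with h3 | h3
  · exact expensive 2 (32 / 3) 6 (by norm_num) (by norm_num) (by norm_num) (by norm_num)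
      (by norm_num) (by norm_num) h2 (by norm_num; linarith)
  -- The remaining payments satisfy p_1 ≤ 2 < 2e, p_2 ≤ 6 < 4e and p_3 ≤ 32 < 12e; the last
  -- inequality is the tight one.
  have hbox : p ∈ priceBox := by
    refine ⟨by linarith, by linarith, hp 2, by linarith, hp 3, by linarith⟩
  have cont : ∀ k : ℕ, k ≤ 2 → p k ≤ 40 → p (k + 1) ≤ 40 →
      objective p k (gammaLow p k) ≤ programValue →
      ∃ P : Plan n, P.T = T ∧ P.p = p ∧ P.i = i ∧
      P.Admissible ∧ n * P.mean P.T (Plan.wins P.i P.T) / P.T ≤ programValue + δ := by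
    intro k hk2 hpk hpk' hobj
    have hγ0 := gammaLow_nonneg hp k
    have hγ1 := gammaLow_le_one p k
    obtain ⟨P, rfl, rfl, rfl, hB⟩ :=
      Plan.exists_blocking T p i k fun t => ⌊(1 - ε) * gammaLow p k * t⌋₊
    refine ⟨P, rfl, rfl, rfl, hB.admissible, ?_⟩
    have hk2' : (k : ℝ) ≤ 2 := by exact_mod_cast hk2
    have h4 := Plan.wins_fraction_le_objective hε (by linarith) (by norm_num) hη hp hp1
      (by linarith) hpk hpk' hB (Plan.hasDensity_floor (mul_nonneg (by linarith) hγ0)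
        (mul_le_one₀ (by linarith) hγ0 hγ1)) (by linarith) hT3
    have h5 : 4 * (k : ℝ) / (η * n) ≤ ε / 80 :=
      le_trans (div_le_div_of_nonneg_right (by linarith) (by positivity)) hnη
    linarith
  rcases min_le_iff.1 (min_mu_le_programValue hbox) with h | h
  · exact cont 1 (by norm_num) (by linarith) (by norm_num; linarith)
      ((objective_gammaLow_le_mu (hp 1)).trans h)
  · exact cont 2 (by norm_num) (by linarith) (by norm_num; linarith)
      ((objective_gammaLow_le_mu (hp 2)).trans h)

/-! ### From plans to the bound on robustness -/

theorem Plan.wins_le {n : ℕ} (j : Fin n) (t : ℕ) (h : Fin t → Round n) : Plan.wins j t h ≤ t := by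
  induction t with
  | zero => exact le_of_eq (by simp [Plan.wins, Plan.total])
  | succ t ih =>
    have e : Plan.wins j (t + 1) h = Plan.wins j t (Fin.init h) +
      if (h (Fin.last t)).2 = some j then 1 else 0 := rfl
    rw [e]
    have := ih (Fin.init h)
    push_cast
    split_ifs <;> linarith

/-- The robustness factor of an aggressive strategy is at most the fraction of her ideal utility
that the agent obtains against a coordinated deterministic plan. -/
theorem IsRobust.le_wins_fraction {n : ℕ} {P : Plan n} (hP : P.Admissible) {F : Fin n → Measure ℝ}
    (hF : ∀ j, IsProbabilityMeasure (F j)) (hV : ∀ j, ∀ᵐ x ∂(F j), x ∈ Set.Icc (0 : ℝ) 1)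
    (hpos : 0 < idealUtility (F P.i) (1 / n)) {ρ : ℝ → I}
    (hρ : IsTopQuantileRule (F P.i) (1 / n) ρ) {c : ℝ}
    (hc : IsRobust (fun _ => 1 / (n : ℝ)) P.T P.p F P.i (aggressive n ρ hρ.measurable) c) :
    c ≤ n * P.mean P.T (Plan.wins P.i P.T) / P.T := by
  have h1 := hc (P.profile (aggressive n ρ hρ.measurable)) (by simp [Plan.profile])
  rw [Plan.expectedUtility_eq hP hρ.mean_eq (hV P.i), hρ.optimal, mul_comm c] at h1
  exact le_of_mul_le_mul_left h1 hpos

end GeneralCost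

theorem theorem2 (lam : ℝ) (hlam : GeneralCost.programValue < lam) :
    ∃ n : ℕ, 2 ≤ n ∧ ∃ C : ℝ, ∀ T : ℕ, 2 ≤ T →
      ∀ p : ℕ → ℝ, (∀ k, 0 ≤ p k) →
      ∀ F : Fin n → MeasureTheory.Measure ℝ,
        (∀ j, MeasureTheory.IsProbabilityMeasure (F j)) →
        (∀ j, ∀ᵐ x ∂(F j), x ∈ Set.Icc (0 : ℝ) 1) →
      ∀ i : Fin n, 0 < GeneralCost.idealUtility (F i) (1 / n) →
      ∀ (ρ : ℝ → unitInterval) (hρ : GeneralCost.IsTopQuantileRule (F i) (1 / n) ρ) (c : ℝ),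
        GeneralCost.IsRobust (fun _ => 1 / (n : ℝ)) T p F i
            (GeneralCost.aggressive n ρ hρ.measurable) c →
          c ≤ lam + C * Real.sqrt (Real.log T / T) := by

  obtain ⟨n, hn, T₀, hplan⟩ := GeneralCost.exists_plan (sub_pos.2 hlam)
  have hlam0 : 0 < lam := by linarith [GeneralCost.half_le_programValue]
  have hlog : 0 < Real.log 2 := Real.log_pos one_lt_two
  -- A is a lower bound for the square root over 2 ≤ T ≤ T₀, so C = n/A makes the error term at
  -- least n there. That suffices, because the fraction n E[wins]/T never exceeds n; for T ≥ T₀ the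
  -- error term is not needed.
  set A := Real.sqrt (Real.log 2 / (T₀ + 1)) with hA
  have hA0 : 0 < A := Real.sqrt_pos.2 (by positivity)
  refine ⟨n, hn, n / A, fun T hT p hp F hF hV i hpos ρ hρ c hc => ?_⟩
  have hTpos : (0 : ℝ) < T := by exact_mod_cast (by omega : 0 < T)
  have hs : 0 ≤ Real.sqrt (Real.log T / T) := Real.sqrt_nonneg _
  rcases le_total T₀ T with h | h
  · obtain ⟨P, rfl, rfl, rfl, hP, hle⟩ := hplan T h p hp i
    have h1 := hc.le_wins_fraction hP hF hV hpos hρ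
    have h2 : 0 ≤ n / A * Real.sqrt (Real.log P.T / P.T) := by positivity
    linarith
  · obtain ⟨P, rfl, rfl, rfl, hB⟩ := GeneralCost.Plan.exists_blocking T p i 0 fun _ => 0
    have h1 := hc.le_wins_fraction hB.admissible hF hV hpos hρ
    have h2 : n * P.mean P.T (GeneralCost.Plan.wins P.i P.T) / P.T ≤ n := by
      rw [div_le_iff₀ hTpos]
      exact mul_le_mul_of_nonneg_left
        (GeneralCost.Plan.mean_le_of_le fun h _ => GeneralCost.Plan.wins_le _ _ h) (Nat.cast_nonneg n)
    have h3 : A ≤ Real.sqrt (Real.log P.T / P.T) := by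
      refine Real.sqrt_le_sqrt ?_
      have h4 : (P.T : ℝ) ≤ T₀ + 1 := by
        have : (P.T : ℝ) ≤ T₀ := by exact_mod_cast h
        linarith
      have h5 : Real.log 2 ≤ Real.log P.T := Real.log_le_log two_pos (by exact_mod_cast hT)
      exact div_le_div₀ (hlog.le.trans h5) h5 hTpos h4
    have h4 : (n : ℝ) ≤ n / A * Real.sqrt (Real.log P.T / P.T) := by
      calc (n : ℝ) = n / A * A := by field_simp
        _ ≤ _ := mul_le_mul_of_nonneg_left h3 (by positivity)
    linarith
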